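/- **Setting.** Let $\Sigma=\{1,\dots,d\}$, $T>0$, $0<\kappa\le M$, $A=[\kappa,M]^d$, and let $P(\Sigma)=\{m\in\mathbb R^d: m_j\ge 0,\ \sum_j m_j=1\}$; $|\cdot|$ is the Euclidean norm. Let $L:\Sigma\times A\to\mathbb R$ be continuous in its second argument, let $F,G:\Sigma\times P(\Sigma)\to\mathbb R$, and set $H(x,p)=\sup_{a\in A}\{-a\cdot p-L(x,a)\}$ for $x\in\Sigma$, $p\in\mathbb R^d$. Assume that for all $(x,p)$ this supremum has a unique maximizer $\alpha^*(x,p)\in A$. For $g:\Sigma\to\mathbb R$ write $\Delta g(x)=(g(y)-g(x))_{y\in\Sigma}\in\mathbb R^d$; for $g:\Sigma^N\to\mathbb R$ let $\Delta^j g(\boldsymbol x)\in\mathbb R^d$ be the same difference in the $j$-th coordinate; $\Delta^xU$ is the difference of $U(t,\cdot,m)$. A function $f$ on $P(\Sigma)$ has derivative $D^mf:P(\Sigma)\times\Sigma\to\mathbb R^d$ if $[D^mf(m,y)]_z=\lim_{s\to0^+}\frac{f(m+s(\delta_z-\delta_y))-f(m)}{s}$, the limit being taken only across those $s>0$ for which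 $m+s(\delta_z-\delta_y)\in P(\Sigma)$ (where there are none, no condition is imposed); $f$ is $C^1$ if $D^mf$ is continuous in $m$ on $P(\Sigma)$. The *Master Equation* for $U:[0,T]\times\Sigma\times P(\Sigma)\to\mathbb R$ is $$-\partial_tU+H(x,\Delta^xU)-\sum_{y\in\Sigma}D^mU(t,x,m,y)\cdot\alpha^*(y,\Delta^yU(t,y,m))\,m(y)=F(x,m),\qquad U(T,x,m)=G(x,m).$$ A *classical solution* is a $U$ that is jointly continuous, $C^1$ in $t$ on $[0,T]$, $C^1$ in $m$, and satisfies this on all of $[0,T]\times\Sigma\times P(\Sigma)$; it is *regular* if moreover $D^mU(t,x,\cdot)$ is Lipschitz continuous in $m$, uniformly in $(t,x)$. For $N\ge2$ and $\boldsymbol x\in\Sigma^N$ let $m^N_{\boldsymbol x}=\frac1N\sum_j\delta_{x_j}$ and $m^{N,i}_{\boldsymbol x}=\frac1{N-1}\sum_{j\ne i}\delta_{x_j}$. The value functions $v^{N,i}:[0,T]\times\Sigma^N\to\mathbb R$, $i=1,\dots,N$, of the $N$-player game are the classical solution of $$-\partial_tv^{N,i}-\sum_{j\neq i}\alpha^*(x_j,\Delta^jv^{N,j})\cdot\Delta^jv^{N,i}+H(x_i,\Delta^iv^{N,i})=F(x_i,m^{N,i}_{\boldsymbol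 x}),\qquad v^{N,i}(T,\boldsymbol x)=G(x_i,m^{N,i}_{\boldsymbol x}).\tag{HJB}$$ **Theorem 3.1.** Assume * **(H1)** for all $x\in\Sigma$, $H(x,\cdot)$ and $\alpha^*(x,\cdot)$ are Lipschitz continuous on $\{|p|\le K\}$, where $K$ is a fixed constant that is large enough, namely $K\ge2\sqrt d\,\bigl(\|G\|_\infty+T(\|L\|_\infty+\|F\|_\infty)\bigr)$ (sup norms over $\Sigma\times P(\Sigma)$ for $F$ and $G$, over $\Sigma\times A$ for $L$), and that the Master Equation has a regular solution $U$. Then there is a constant $C$ such that for all $N\ge2$, every solution $(v^{N,i})_{i\le N}$ of (HJB), all $t_0\in[0,T]$, $\boldsymbol x\in\Sigma^N$, $m_0\in P(\Sigma)$ and $i\in\{1,\dots,N\}$, $$\frac1N\sum_{k=1}^N\bigl|v^{N,k}(t_0,\boldsymbol x)-U(t_0,x_k,m^N_{\boldsymbol x})\bigr|\le\frac CN,$$ $$\|w^{N,i}(t_0,\cdot,m_0)-U(t_0,\cdot,m_0)\|_{L^1(m_0)}:=\sum_{x\in\Sigma}|w^{N,i}(t_0,x,m_0)-U(t_0,x,m_0)|\,m_0(x)\le\frac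 C{\sqrt N},$$ where $w^{N,i}(t_0,x,m_0)=\sum_{\boldsymbol x\in\Sigma^N:\ x_i=x}v^{N,i}(t_0,\boldsymbol x)\prod_{j\ne i}m_0(x_j)$. -/

import Mathlib

open Filter Topology Set
open scoped NNReal

noncomputable section

namespace FiniteMFG

/-- Vectors of `ℝ^d` with the Euclidean norm, indexed by the finite state space `Fin d`. -/
abbrev Vec (d : ℕ) : Type := EuclideanSpace ℝ (Fin d)

/-- The space of probability measures on the state space, as a simplex of `ℝ^d`. -/
def simplex (d : ℕ) : Set (Vec d) := {m | (∀ j, 0 ≤ m j) ∧ ∑ j, m j = 1}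

/-- The Dirac mass at the state `x`. -/
def dirac {d : ℕ} (x : Fin d) : Vec d := EuclideanSpace.single x 1

/-- The finite difference `Δ g (x) = (g y - g x)_y`. -/
def diff {d : ℕ} (g : Fin d → ℝ) (x : Fin d) : Vec d := WithLp.toLp 2 fun y => g y - g x

/-- The finite difference `Δ^j g (x)` with respect to the `j`-th coordinate. -/
def diffAt {d N : ℕ} (j : Fin N) (g : (Fin N → Fin d) → ℝ) (x : Fin N → Fin d) : Vec d :=
  WithLp.toLp 2 fun y => g (Function.update x j y) - g x

/-- The empirical measure of all the players. -/
def empirical {d N : ℕ} (x : Fin N → Fin d) : Vec d := (N : ℝ)⁻¹ • ∑ j, dirac (x j)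

/-- The empirical measure of all the players except the `i`-th (meaningful for `2 ≤ N`). -/
def empiricalExcept {d N : ℕ} (i : Fin N) (x : Fin N → Fin d) : Vec d :=
  ((N : ℝ) - 1)⁻¹ • ∑ j ∈ Finset.univ.erase i, dirac (x j)

/-- The set of control values `[κ, M]^d`. -/
def controlSet (d : ℕ) (κ M : ℝ) : Set (Vec d) := {a | ∀ y, a y ∈ Icc κ M}

/-- `a` maximizes `- a · p - ℓ(a)` over the control values. -/
def IsMaximizer {d : ℕ} (κ M : ℝ) (ℓ : Vec d → ℝ) (p a : Vec d) : Prop :=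
  a ∈ controlSet d κ M ∧ IsMaxOn (fun b => - inner ℝ b p - ℓ b) (controlSet d κ M) a

/-- The data of the game, with the standing assumptions: the Lagrangian is continuous in the
control, and the maximizer in the definition of the Hamiltonian is unique. Only the values of `L`
on the control set and of `F`, `G` on the simplex are ever used. -/
structure Game (d : ℕ) where
  T : ℝ
  κ : ℝ
  M : ℝ
  L : Fin d → Vec d → ℝ
  F : Fin d → Vec d → ℝ
  G : Fin d → Vec d → ℝ
  T_pos : 0 < T
  κ_pos : 0 < κ
  κ_le_M : κ ≤ M
  L_cont : ∀ x, ContinuousOn (L x) (controlSet d κ M)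
  unique_maximizer : ∀ x p, ∃! a, IsMaximizer κ M (L x) p a

/-- `D` is the derivative of `f` on the simplex: `D m y z` is the right derivative of `f` at `m`
in the direction `δ_z - δ_y`, the limit being taken only across those `s > 0` for which
`m + s (δ_z - δ_y)` stays in the simplex (there are none if `m y = 0` and `z ≠ y`, and there the
value of a continuous `D` is the limit of its values at the admissible points). -/
def IsSimplexDeriv {d : ℕ} (f : Vec d → ℝ) (D : Vec d → Fin d → Vec d) : Prop :=
  ∀ m ∈ simplex d, ∀ y z : Fin d,
    Tendsto (fun s : ℝ => (f (m + s • (dirac z - dirac y)) - f m) / s)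
      (𝓝[{s : ℝ | 0 < s ∧ m + s • (dirac z - dirac y) ∈ simplex d}] 0) (𝓝 (D m y z))

namespace Game

variable {d : ℕ} (𝓖 : Game d)

/-- The set of control values of the game. -/
def A : Set (Vec d) := controlSet d 𝓖.κ 𝓖.M

/-- The Hamiltonian `H(x, p) = sup_{a ∈ A} (- a · p - L(x, a))`. -/
def H (x : Fin d) (p : Vec d) : ℝ := sSup ((fun a => - inner ℝ a p - 𝓖.L x a) '' 𝓖.A)

/-- The maximizer `α^*(x, p)` in the definition of the Hamiltonian. -/
def αStar (x : Fin d) (p : Vec d) : Vec d := (𝓖.unique_maximizer x p).choose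

/-- `H` and `α^*` are Lipschitz continuous in `p` for `|p| ≤ K`. -/
def H1 (K : ℝ) : Prop :=
  ∀ x, (∃ C : ℝ≥0, LipschitzOnWith C (𝓖.H x) (Metric.closedBall 0 K)) ∧
    (∃ C : ℝ≥0, LipschitzOnWith C (𝓖.αStar x) (Metric.closedBall 0 K))

/-- `K` is at least `2 √d (‖G‖ + T (‖L‖ + ‖F‖))`, with sup norms over the control set and over the
simplex: the a priori size of the finite differences of the value functions. -/
def LargeRadius (K : ℝ) : Prop :=
  ∀ x y z : Fin d, ∀ a ∈ 𝓖.A, ∀ m ∈ simplex d, ∀ m' ∈ simplex d,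
    2 * √(d : ℝ) * (|𝓖.G x m| + 𝓖.T * (|𝓖.L y a| + |𝓖.F z m'|)) ≤ K

/-- `v i t x` is a classical solution of the Hamilton-Jacobi-Bellman system of the `N`-player game
with the mean field costs `F (x_i, m_x^{N,i})` and `G (x_i, m_x^{N,i})`. -/
def IsHJBSolution {N : ℕ} (v : Fin N → ℝ → (Fin N → Fin d) → ℝ) : Prop :=
  (∀ i x, ∀ t ∈ Icc 0 𝓖.T, ∃ v' : ℝ,
    HasDerivWithinAt (fun s => v i s x) v' (Icc 0 𝓖.T) t ∧
    - v' - ∑ j ∈ Finset.univ.erase i,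
          inner ℝ (𝓖.αStar (x j) (diffAt j (v j t) x)) (diffAt j (v i t) x)
        + 𝓖.H (x i) (diffAt i (v i t) x)
      = 𝓖.F (x i) (empiricalExcept i x)) ∧
  ∀ i x, v i 𝓖.T x = 𝓖.G (x i) (empiricalExcept i x)

/-- `U` is a classical solution of the Master Equation, with time derivative `Ut` and with
derivative `D t x m y` with respect to the measure. -/
structure IsClassicalSolution (U Ut : ℝ → Fin d → Vec d → ℝ)
    (D : ℝ → Fin d → Vec d → Fin d → Vec d) : Prop where
  cont : ∀ x, ContinuousOn (fun q : ℝ × Vec d => U q.1 x q.2) (Icc 0 𝓖.T ×ˢ simplex d)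
  deriv_time : ∀ x, ∀ m ∈ simplex d, ∀ t ∈ Icc 0 𝓖.T,
    HasDerivWithinAt (fun s => U s x m) (Ut t x m) (Icc 0 𝓖.T) t
  cont_deriv_time : ∀ x, ∀ m ∈ simplex d, ContinuousOn (fun t => Ut t x m) (Icc 0 𝓖.T)
  deriv_measure : ∀ t ∈ Icc 0 𝓖.T, ∀ x, IsSimplexDeriv (U t x) (D t x)
  cont_deriv_measure : ∀ t ∈ Icc 0 𝓖.T, ∀ x y, ContinuousOn (fun m => D t x m y) (simplex d)
  equation : ∀ t ∈ Icc 0 𝓖.T, ∀ x, ∀ m ∈ simplex d,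
    - Ut t x m + 𝓖.H x (diff (fun z => U t z m) x)
        - ∑ y, inner ℝ (D t x m y) (𝓖.αStar y (diff (fun z => U t z m) y)) * m y
      = 𝓖.F x m
  terminal : ∀ x, ∀ m ∈ simplex d, U 𝓖.T x m = 𝓖.G x m

/-- `U` is a regular solution of the Master Equation: a classical solution whose derivative with
respect to the measure is Lipschitz continuous in the measure, uniformly in time and state. -/
def IsRegularSolution (U : ℝ → Fin d → Vec d → ℝ) : Prop :=
  ∃ Ut D, 𝓖.IsClassicalSolution U Ut D ∧
    ∃ C : ℝ≥0, ∀ t ∈ Icc 0 𝓖.T, ∀ x y, LipschitzOnWith C (fun m => D t x m y) (simplex d)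

end Game

/-- `w^{N,i}(t, x, m₀)`: the average of `v^{N,i}(t, ·)` over the states of the players other than
`i`, with respect to the product of copies of `m₀`, the state of player `i` being `x`. -/
def averaged {d N : ℕ} (v : Fin N → ℝ → (Fin N → Fin d) → ℝ) (i : Fin N) (t : ℝ) (x : Fin d)
    (m₀ : Vec d) : ℝ :=
  ∑ y : Fin N → Fin d with y i = x, v i t y * ∏ j ∈ Finset.univ.erase i, m₀ (y j)

/-- The norm of `L¹(m₀)`. -/
def normL1 {d : ℕ} (m₀ : Vec d) (g : Fin d → ℝ) : ℝ := ∑ x, |g x| * m₀ x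

end FiniteMFG

end

/-! Put `u i t x = U t (x i) (empiricalExcept i x)` (`playerValue` below). It has the terminal
values of `v` and nearly solves the same system: a jump of player `j ≠ i` moves mass `1/(N-1)`, so
Lipschitz continuity of the measure derivative gives `Δ^j u i = D/(N-1) + O(1/N²)`. Summing over the
other players, the transport term of the Master Equation becomes that of the game up to `O(1/N)`
(`abs_transport_sub_le`).

The comparison is purely deterministic. Consider a maximum of `±(u - v)` over signs, players and
configurations. The sum of the differences of `u - v` against the controls of `v` has a sign there,
since controls are nonnegative. The other terms are `O(1/N)` plus a constant, independent of `N`,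
times the maximum; the constant does not grow because each `Δ^j u i` is itself `O(1/N)`. Gronwall at
spatial maxima then gives `|u - v| = O(1/N)` uniformly (`abs_playerValue_sub_le`).

The Lipschitz hypothesis is only local, so all differences of `U` and of `v` must first be placed in
the ball of radius `K`. Writing `H` through its maximizer makes both equations linear transport
equations with running cost `L + F`, and the maximum principle bounds their solutions.

Finally `U` is Lipschitz in the measure for the `ℓ¹` distance. Replacing `empiricalExcept` by
`empirical` costs `O(1/N)`, and averaging over independent players costs `O(1/√N)` by a variance
bound. -/

namespace FiniteMFG

/-! ### Backward maximum principles -/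

section MaximumPrinciple

variable {X : Type*} [TopologicalSpace X] {S : Set X} {T : ℝ} {f : ℝ → X → ℝ}

/-- A maximum principle, backwards in time: if the time derivative is positive at all the spatial
maxima above the level `B`, then `f` stays below `B` if it ends there. -/
theorem le_of_deriv_pos_at_max (hS : IsCompact S) {B : ℝ}
    (hc : ContinuousOn (fun q : ℝ × X => f q.1 q.2) (Icc 0 T ×ˢ S))
    (hT : ∀ x ∈ S, f T x ≤ B)
    (hmax : ∀ t ∈ Icc 0 T, ∀ x ∈ S, (∀ y ∈ S, f t y ≤ f t x) → B < f t x →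
      ∃ f', HasDerivWithinAt (fun s => f s x) f' (Icc 0 T) t ∧ 0 < f') :
    ∀ t ∈ Icc 0 T, ∀ x ∈ S, f t x ≤ B := by
  intro t ht x hx
  by_contra! hB
  obtain ⟨⟨τ, ξ⟩, ⟨hτ, hξ⟩, hm⟩ :=
    (isCompact_Icc.prod hS).exists_isMaxOn ⟨(t, x), ht, hx⟩ hc
  have hle : ∀ s ∈ Icc 0 T, ∀ y ∈ S, f s y ≤ f τ ξ := fun s hs y hy =>
    hm (show (s, y) ∈ Icc 0 T ×ˢ S from ⟨hs, hy⟩)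
  have hτB : B < f τ ξ := hB.trans_le (hle t ht x hx)
  have hτT : τ < T := lt_of_le_of_ne hτ.2 fun h => by
    subst h
    exact absurd (hT ξ hξ) (not_le.2 hτB)
  obtain ⟨f', hd, hpos⟩ := hmax τ hτ ξ hξ (fun y hy => hle τ hτ y hy) hτB
  have hloc : IsLocalMaxOn (fun s => f s ξ) (Icc 0 T) τ :=
    eventually_nhdsWithin_of_forall fun s hs => hle s hs ξ hξ
  -- The maximum may occur at `τ = 0`, so only the forward direction is used; it is available
  -- because `τ < T`.
  have hcone : T - τ ∈ posTangentConeAt (Icc 0 T) τ := by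
    refine sub_mem_posTangentConeAt_of_segment_subset ?_
    rw [segment_eq_Icc hτT.le]
    exact Icc_subset_Icc_left hτ.1
  have := hloc.hasFDerivWithinAt_nonpos hd.hasFDerivWithinAt hcone
  simp at this
  nlinarith [mul_pos (sub_pos.2 hτT) hpos]

/-- If the time derivative is at least `-c` at all the spatial maxima, then `f` is at most its
terminal bound plus `T c`. -/
theorem le_add_mul_of_deriv_at_max (hS : IsCompact S) {g c : ℝ} (hc0 : 0 ≤ c)
    (hc : ContinuousOn (fun q : ℝ × X => f q.1 q.2) (Icc 0 T ×ˢ S))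
    (hT : ∀ x ∈ S, f T x ≤ g)
    (hmax : ∀ t ∈ Icc 0 T, ∀ x ∈ S, (∀ y ∈ S, f t y ≤ f t x) →
      ∃ f', HasDerivWithinAt (fun s => f s x) f' (Icc 0 T) t ∧ -f' ≤ c) :
    ∀ t ∈ Icc 0 T, ∀ x ∈ S, f t x ≤ g + T * c := by
  intro t ht x hx
  have hT0 : 0 ≤ T := ht.1.trans ht.2
  refine le_of_forall_pos_le_add fun ε hε => ?_
  have hδ : 0 < ε / (T + 1) := by positivity
  -- The extra slope `ε / (T + 1)` makes the derivative strictly positive and costs at most `ε`; the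
  -- `+ 1` covers `T = 0`.
  have key := le_of_deriv_pos_at_max (f := fun s y => f s y - (T - s) * (c + ε / (T + 1)))
    (B := g) hS (hc.sub (by fun_prop)) (by simpa using hT) (fun s hs y hy hy' _ => by
      obtain ⟨f', hd, hf'⟩ := hmax s hs y hy fun z hz => by simpa using hy' z hz
      refine ⟨f' - (-1) * (c + ε / (T + 1)), ?_, by linarith⟩
      exact hd.sub ((((hasDerivAt_id s).const_sub T).mul_const _).hasDerivWithinAt)) t ht x hx
  have h1 : (T - t) * (c + ε / (T + 1)) ≤ T * (c + ε / (T + 1)) :=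
    mul_le_mul_of_nonneg_right (by linarith [ht.1]) (by positivity)
  have h2 : T * (ε / (T + 1)) ≤ ε := by
    rw [mul_div_assoc', div_le_iff₀ (by positivity)]
    nlinarith
  nlinarith

/-- A Gronwall lemma at spatial maxima. -/
theorem le_mul_exp_of_deriv_at_max (hS : IsCompact S) {c₀ c₁ : ℝ} (hc₀ : 0 ≤ c₀) (hc₁ : 0 ≤ c₁)
    (hc : ContinuousOn (fun q : ℝ × X => f q.1 q.2) (Icc 0 T ×ˢ S))
    (hT : ∀ x ∈ S, f T x ≤ 0)
    (hmax : ∀ t ∈ Icc 0 T, ∀ x ∈ S, (∀ y ∈ S, f t y ≤ f t x) →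
      ∃ f', HasDerivWithinAt (fun s => f s x) f' (Icc 0 T) t ∧ -f' ≤ c₀ + c₁ * f t x) :
    ∀ t ∈ Icc 0 T, ∀ x ∈ S, f t x ≤ c₀ * Real.exp ((c₁ + 1) * T) := by
  intro t ht x hx
  -- The weight is at most `1`, so weighted values above `c₀` force `f > c₀`. The spare `1` in the
  -- rate then gives `(c₁ + 1) f + f' ≥ f - c₀ > 0`.
  have key := le_of_deriv_pos_at_max (f := fun s y => Real.exp ((c₁ + 1) * (s - T)) * f s y)
    (B := c₀) hS (ContinuousOn.mul (by fun_prop) hc)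
    (fun y hy => by simpa using (hT y hy).trans hc₀) (fun s hs y hy hy' hB => by
      have he : 0 < Real.exp ((c₁ + 1) * (s - T)) := Real.exp_pos _
      have he1 : Real.exp ((c₁ + 1) * (s - T)) ≤ 1 := by
        rw [Real.exp_le_one_iff]
        nlinarith [hs.2]
      obtain ⟨f', hd, hf'⟩ := hmax s hs y hy fun z hz => le_of_mul_le_mul_left (hy' z hz) he
      have hfpos : 0 < f s y := pos_of_mul_pos_right (hc₀.trans_lt hB) he.le
      have hfc : c₀ < f s y := hB.trans_le (by nlinarith)
      have hde : HasDerivAt (fun s => Real.exp ((c₁ + 1) * (s - T)))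
          (Real.exp ((c₁ + 1) * (s - T)) * ((c₁ + 1) * 1)) s :=
        (((hasDerivAt_id s).sub_const T).const_mul (c₁ + 1)).exp
      refine ⟨_, hde.hasDerivWithinAt.mul hd, ?_⟩
      have : 0 < (c₁ + 1) * f s y + f' := by nlinarith
      nlinarith [mul_pos he this]) t ht x hx
  have h2 : f t x = Real.exp ((c₁ + 1) * (T - t)) * (Real.exp ((c₁ + 1) * (t - T)) * f t x) := by
    rw [← mul_assoc, ← Real.exp_add, ← mul_add]
    simp
  rw [h2, mul_comm c₀]
  refine mul_le_mul_of_nonneg (Real.exp_le_exp.2 ?_) key (Real.exp_pos _).le hc₀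
  exact mul_le_mul_of_nonneg_left (by linarith [ht.1]) (by linarith)

end MaximumPrinciple

/-! ### The Hamiltonian through its maximizer, and signs of inner products -/

namespace Game

variable {d : ℕ} (𝓖 : Game d)

theorem isMaximizer_αStar (x : Fin d) (p : Vec d) :
    IsMaximizer 𝓖.κ 𝓖.M (𝓖.L x) p (𝓖.αStar x p) :=
  (𝓖.unique_maximizer x p).choose_spec.1

theorem αStar_mem (x : Fin d) (p : Vec d) : 𝓖.αStar x p ∈ 𝓖.A :=
  (𝓖.isMaximizer_αStar x p).1

theorem αStar_nonneg (x : Fin d) (p : Vec d) (y : Fin d) : 0 ≤ 𝓖.αStar x p y :=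
  𝓖.κ_pos.le.trans (𝓖.αStar_mem x p y).1

theorem H_eq (x : Fin d) (p : Vec d) :
    𝓖.H x p = - inner ℝ (𝓖.αStar x p) p - 𝓖.L x (𝓖.αStar x p) := by
  obtain ⟨hA, hm⟩ := 𝓖.isMaximizer_αStar x p
  refine IsGreatest.csSup_eq ⟨⟨_, hA, rfl⟩, ?_⟩
  rintro _ ⟨b, hb, rfl⟩
  exact hm hb

end Game

theorem norm_le_sqrt_mul {d : ℕ} (p : Vec d) {b : ℝ} (hb : 0 ≤ b) (h : ∀ y, |p y| ≤ b) :
    ‖p‖ ≤ √(d : ℝ) * b := by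
  rw [EuclideanSpace.norm_eq, ← Real.sqrt_sq hb, ← Real.sqrt_mul (Nat.cast_nonneg d)]
  refine Real.sqrt_le_sqrt ?_
  calc ∑ y, ‖p y‖ ^ 2 ≤ ∑ _y : Fin d, b ^ 2 :=
        Finset.sum_le_sum fun y _ => pow_le_pow_left₀ (norm_nonneg _) (h y) 2
    _ = d * b ^ 2 := by simp

theorem inner_nonpos_of_nonneg_of_nonpos {d : ℕ} {a p : Vec d} (ha : ∀ y, 0 ≤ a y)
    (hp : ∀ y, p y ≤ 0) : inner ℝ a p ≤ 0 := by
  rw [PiLp.inner_apply]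
  exact Finset.sum_nonpos fun y _ => by
    simpa using mul_nonpos_of_nonpos_of_nonneg (hp y) (ha y)

theorem inner_nonneg_of_nonneg_of_nonneg {d : ℕ} {a p : Vec d} (ha : ∀ y, 0 ≤ a y)
    (hp : ∀ y, 0 ≤ p y) : 0 ≤ inner ℝ a p := by
  rw [PiLp.inner_apply]
  exact Finset.sum_nonneg fun y _ => by simpa using mul_nonneg (hp y) (ha y)

end FiniteMFG

/-! ### The simplex and calculus along moves of mass -/

namespace FiniteMFG

variable {d : ℕ}

theorem convex_simplex : Convex ℝ (simplex d) := by
  intro m hm m' hm' a b ha hb hab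
  refine ⟨fun j => ?_, ?_⟩
  · simpa using add_nonneg (mul_nonneg ha (hm.1 j)) (mul_nonneg hb (hm'.1 j))
  · simp [Finset.sum_add_distrib, ← Finset.mul_sum, hm.2, hm'.2, hab]

theorem dirac_apply (x y : Fin d) : dirac x y = if y = x then 1 else 0 := by
  simp [dirac]

theorem dirac_mem_simplex (x : Fin d) : dirac x ∈ simplex d :=
  ⟨fun j => by rw [dirac_apply]; positivity, by simp [dirac_apply]⟩

theorem norm_dirac (x : Fin d) : ‖dirac x‖ = 1 := by simp [dirac]

theorem norm_dirac_sub_le (z y : Fin d) : ‖dirac z - dirac y‖ ≤ 2 :=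
  (norm_sub_le _ _).trans (by simp only [norm_dirac]; norm_num)

theorem le_one_of_mem_simplex {m : Vec d} (hm : m ∈ simplex d) (j : Fin d) : m j ≤ 1 :=
  hm.2 ▸ Finset.single_le_sum (fun k _ => hm.1 k) (Finset.mem_univ j)

theorem norm_le_one_of_mem_simplex {m : Vec d} (hm : m ∈ simplex d) : ‖m‖ ≤ 1 := by
  rw [EuclideanSpace.norm_eq, Real.sqrt_le_one, ← hm.2]
  refine Finset.sum_le_sum fun j _ => ?_
  rw [Real.norm_eq_abs, sq_abs]
  nlinarith [hm.1 j, le_one_of_mem_simplex hm j]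

theorem isCompact_simplex : IsCompact (simplex d) := by
  refine Metric.isCompact_of_isClosed_isBounded ?_ ?_
  · have h1 : IsClosed (⋂ j, {m : Vec d | 0 ≤ m j}) :=
      isClosed_iInter fun j => isClosed_le continuous_const (by fun_prop)
    have h2 : IsClosed {m : Vec d | ∑ j, m j = 1} := isClosed_eq (by fun_prop) continuous_const
    have h3 : simplex d = (⋂ j, {m : Vec d | 0 ≤ m j}) ∩ {m : Vec d | ∑ j, m j = 1} := by
      ext m
      simp [simplex]
    exact h3 ▸ h1.inter h2
  · exact (Metric.isBounded_closedBall (x := (0 : Vec d)) (r := 1)).subset fun m hm => by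
      simpa using norm_le_one_of_mem_simplex hm

theorem add_smul_mem_simplex {m e : Vec d} {h s : ℝ} (hm : m ∈ simplex d)
    (hh : m + h • e ∈ simplex d) (hs : s ∈ Icc 0 h) : m + s • e ∈ simplex d := by
  rcases eq_or_lt_of_le (hs.1.trans hs.2) with h0 | h0
  · have : s = 0 := le_antisymm (hs.2.trans h0.symm.le) hs.1
    simpa [this] using hm
  · have := convex_simplex.add_smul_mem hm hh (t := s / h)
      ⟨div_nonneg hs.1 h0.le, (div_le_one h0).2 hs.2⟩
    rwa [smul_smul, div_mul_cancel₀ _ h0.ne'] at this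

section Derivative

variable {f : Vec d → ℝ} {D : Vec d → Fin d → Vec d}

/-- The mean value inequality in an elementary direction of the simplex. -/
theorem IsSimplexDeriv.abs_sub_sub_le (hf : IsSimplexDeriv f D) (hc : ContinuousOn f (simplex d))
    {m : Vec d} (hm : m ∈ simplex d) {y z : Fin d} {h : ℝ} (h0 : 0 ≤ h)
    (hh : m + h • (dirac z - dirac y) ∈ simplex d) {a ε : ℝ}
    (hD : ∀ s ∈ Icc 0 h, |D (m + s • (dirac z - dirac y)) y z - a| ≤ ε) :
    |f (m + h • (dirac z - dirac y)) - f m - h * a| ≤ ε * h := by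
  set e : Vec d := dirac z - dirac y
  have hmem : ∀ s ∈ Icc 0 h, m + s • e ∈ simplex d := fun s hs => add_smul_mem_simplex hm hh hs
  have key := norm_image_sub_le_of_norm_deriv_right_le_segment (a := 0) (b := h) (C := ε)
    (f := fun s : ℝ => f (m + s • e) - s * a) (f' := fun s => D (m + s • e) y z - 1 * a)
    ((hc.comp (by fun_prop) hmem).sub (by fun_prop)) (fun s hs => ?_)
    (fun s hs => by simpa using hD s (Ico_subset_Icc_self hs)) h ⟨h0, le_rfl⟩
  · simpa [sub_right_comm] using key
  · refine HasDerivWithinAt.sub ?_ ((hasDerivAt_id s).mul_const a).hasDerivWithinAt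
    -- Translating by `s` turns the right derivative along the segment into the simplex derivative
    -- at `m + s • e`; the increments stay admissible as long as `r < h`.
    rw [← hasDerivWithinAt_Ioi_iff_Ici, hasDerivWithinAt_iff_tendsto_slope' self_notMem_Ioi]
    have ht := hf (m + s • e) (hmem s (Ico_subset_Icc_self hs)) y z
    have hmap : Tendsto (fun r : ℝ => r - s) (𝓝[>] s)
        (𝓝[{r : ℝ | 0 < r ∧ m + s • e + r • (dirac z - dirac y) ∈ simplex d}] 0) := by
      rw [tendsto_nhdsWithin_iff]
      constructor
      · have : Tendsto (fun r : ℝ => r - s) (𝓝 s) (𝓝 (s - s)) :=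
          (continuous_id.sub continuous_const).tendsto s
        rw [sub_self] at this
        exact this.mono_left nhdsWithin_le_nhds
      · filter_upwards [Ioo_mem_nhdsGT hs.2] with r hr
        refine ⟨sub_pos.2 hr.1, ?_⟩
        rw [add_assoc, ← add_smul, add_sub_cancel]
        exact hmem r ⟨hs.1.trans hr.1.le, hr.2.le⟩
    refine (ht.comp hmap).congr fun r => ?_
    simp only [Function.comp, slope_def_field]
    rw [add_assoc, ← add_smul, add_sub_cancel]

theorem IsSimplexDeriv.apply_self (hf : IsSimplexDeriv f D) {m : Vec d} (hm : m ∈ simplex d)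
    (y : Fin d) : D m y y = 0 := by
  have h := hf m hm y y
  simp only [sub_self, smul_zero, add_zero, hm, and_true, zero_div] at h
  have : (𝓝[{s : ℝ | 0 < s}] (0 : ℝ)).NeBot := nhdsGT_neBot 0
  exact tendsto_nhds_unique h tendsto_const_nhds

/-- Positive mass at `y` makes small moves from `y` to `z` admissible, and none of them can increase
`f`. Where `m y = 0` and `z ≠ y` the derivative is not tested by any increment. -/
theorem IsSimplexDeriv.nonpos_of_isMaxOn (hf : IsSimplexDeriv f D) {m : Vec d}
    (hm : m ∈ simplex d) (hmax : ∀ m' ∈ simplex d, f m' ≤ f m) {y : Fin d} (hy : 0 < m y)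
    (z : Fin d) : D m y z ≤ 0 := by
  by_cases hzy : z = y
  · rw [hzy, hf.apply_self hm]
  have hmem : ∀ s ∈ Ioo 0 (m y), m + s • (dirac z - dirac y) ∈ simplex d := by
    intro s hs
    refine ⟨fun j => ?_, ?_⟩
    · simp only [PiLp.add_apply, PiLp.smul_apply, PiLp.sub_apply, dirac_apply, smul_eq_mul]
      split_ifs with h1 h2 h2
      · exact absurd (h1.symm.trans h2) hzy
      · linarith [hm.1 j, hs.1]
      · subst h2; linarith [hs.2]
      · linarith [hm.1 j]
    · simp [Finset.sum_add_distrib, Finset.sum_sub_distrib, ← Finset.mul_sum, hm.2, dirac_apply]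
  have hne : (𝓝[{s : ℝ | 0 < s ∧ m + s • (dirac z - dirac y) ∈ simplex d}] 0).NeBot := by
    refine (nhdsGT_neBot (0 : ℝ)).mono ?_
    rw [← nhdsWithin_Ioo_eq_nhdsGT hy]
    exact nhdsWithin_mono _ fun s hs => ⟨hs.1, hmem s hs⟩
  refine le_of_tendsto (hf m hm y z) (eventually_nhdsWithin_of_forall fun s hs => ?_)
  exact div_nonpos_of_nonpos_of_nonneg (sub_nonpos.2 (hmax _ hs.2)) hs.1.le

theorem IsSimplexDeriv.neg (hf : IsSimplexDeriv f D) :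
    IsSimplexDeriv (fun m => - f m) (fun m y => - D m y) := by
  intro m hm y z
  refine (hf m hm y z).neg.congr fun s => ?_
  rw [← neg_div]
  congr 1
  ring

variable {C : ℝ≥0}

theorem IsSimplexDeriv.abs_taylor_le (hf : IsSimplexDeriv f D) (hc : ContinuousOn f (simplex d))
    (hD : ∀ y, LipschitzOnWith C (fun m => D m y) (simplex d))
    {m : Vec d} (hm : m ∈ simplex d) {y z : Fin d} {h : ℝ} (h0 : 0 ≤ h)
    (hh : m + h • (dirac z - dirac y) ∈ simplex d) :
    |f (m + h • (dirac z - dirac y)) - f m - h * D m y z| ≤ 2 * C * h * h := by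
  refine hf.abs_sub_sub_le hc hm h0 hh fun s hs => ?_
  have h1 := (hD y).dist_le_mul _ (add_smul_mem_simplex hm hh hs) _ hm
  rw [dist_eq_norm, dist_eq_norm, add_sub_cancel_left, norm_smul] at h1
  calc _ = ‖(D (m + s • (dirac z - dirac y)) y - D m y) z‖ := by simp
    _ ≤ _ := PiLp.norm_apply_le _ z
    _ ≤ C * (‖s‖ * ‖dirac z - dirac y‖) := h1
    _ ≤ C * (h * 2) := by
      gcongr
      · rw [Real.norm_eq_abs, abs_of_nonneg hs.1]; exact hs.2
      · exact norm_dirac_sub_le z y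
    _ = _ := by ring

/-- A bounded function with a Lipschitz derivative has a bounded derivative. -/
theorem IsSimplexDeriv.abs_deriv_le (hf : IsSimplexDeriv f D) (hc : ContinuousOn f (simplex d))
    (hD : ∀ y, LipschitzOnWith C (fun m => D m y) (simplex d)) {B : ℝ}
    (hB : ∀ m ∈ simplex d, |f m| ≤ B) {m : Vec d} (hm : m ∈ simplex d) (y z : Fin d) :
    |D m y z| ≤ 2 * B + 4 * C := by
  -- At `dirac y` a full unit of mass can go to `z`, so Taylor gives `2B + 2C` there, even if `m y =
  -- 0`; the Lipschitz bound transports this to `m` for another `2C`.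
  have hy := dirac_mem_simplex y
  have h1 := hf.abs_taylor_le hc hD hy (y := y) (z := z) zero_le_one
    (by simpa using dirac_mem_simplex z)
  simp only [one_smul, add_sub_cancel, one_mul, mul_one] at h1
  have h2 := (hD y).dist_le_mul _ hm _ hy
  rw [dist_eq_norm, dist_eq_norm] at h2
  have h3 : |D m y z - D (dirac y) y z| ≤ C * 2 :=
    calc _ = ‖(D m y - D (dirac y) y) z‖ := by simp
      _ ≤ _ := PiLp.norm_apply_le _ z
      _ ≤ C * ‖m - dirac y‖ := h2
      _ ≤ C * 2 := by
        gcongr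
        refine (norm_sub_le _ _).trans ?_
        linarith [norm_le_one_of_mem_simplex hm, norm_le_one_of_mem_simplex hy]
  have h4 := hB _ hy
  have h5 := hB _ (dirac_mem_simplex z)
  rw [abs_le] at *
  constructor <;> linarith [h1.1, h1.2, h3.1, h3.2, h4.1, h4.2, h5.1, h5.2]

theorem IsSimplexDeriv.abs_move_le (hf : IsSimplexDeriv f D) (hc : ContinuousOn f (simplex d))
    {R : ℝ} (hR : ∀ m ∈ simplex d, ∀ y z, |D m y z| ≤ R)
    {m : Vec d} (hm : m ∈ simplex d) {y z : Fin d} {h : ℝ} (h0 : 0 ≤ h)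
    (hh : m + h • (dirac z - dirac y) ∈ simplex d) :
    |f (m + h • (dirac z - dirac y)) - f m| ≤ R * h := by
  simpa using hf.abs_sub_sub_le hc hm h0 hh (a := 0) (ε := R) fun s hs => by
    simpa using hR _ (add_smul_mem_simplex hm hh hs) y z

end Derivative

/-- A function whose variation along elementary moves of mass is controlled is Lipschitz for the
`ℓ¹` distance on the simplex. -/
theorem abs_sub_le_sum_of_move {f : Vec d → ℝ} {R : ℝ}
    (hf : ∀ m ∈ simplex d, ∀ (y z : Fin d) (h : ℝ), 0 ≤ h →
      m + h • (dirac z - dirac y) ∈ simplex d → |f (m + h • (dirac z - dirac y)) - f m| ≤ R * h)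
    (hR : 0 ≤ R) {m m' : Vec d} (hm : m ∈ simplex d) (hm' : m' ∈ simplex d) :
    |f m - f m'| ≤ R * ∑ j, |m j - m' j| := by
  -- Induction on the number of coordinates where the measures disagree: moving the smaller of a
  -- surplus and a deficit settles at least one of them.
  induction hn : (Finset.univ.filter fun j => m j ≠ m' j).card using Nat.strong_induction_on
    generalizing m with
  | _ n ih =>
  by_cases heq : m = m'
  · simp [heq]
  have hsum : ∑ j, m j = ∑ j, m' j := hm.2.trans hm'.2.symm
  have hne : ∃ j, m j ≠ m' j := by
    by_contra! h
    exact heq (PiLp.ext h)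
  obtain ⟨y, hy⟩ : ∃ y, m' y < m y := by
    by_contra! h
    obtain ⟨j, hj⟩ := hne
    exact hsum.not_lt (Finset.sum_lt_sum (fun k _ => h k)
      ⟨j, Finset.mem_univ j, lt_of_le_of_ne (h j) hj⟩)
  obtain ⟨z, hz⟩ : ∃ z, m z < m' z := by
    by_contra! h
    obtain ⟨j, hj⟩ := hne
    exact hsum.not_gt (Finset.sum_lt_sum (fun k _ => h k)
      ⟨j, Finset.mem_univ j, lt_of_le_of_ne (h j) hj.symm⟩)
  have hyz : y ≠ z := fun h => by subst h; exact lt_asymm hy hz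
  set h := min (m y - m' y) (m' z - m z) with hh
  have h0 : 0 < h := lt_min (sub_pos.2 hy) (sub_pos.2 hz)
  have hhy : h ≤ m y - m' y := min_le_left _ _
  have hhz : h ≤ m' z - m z := min_le_right _ _
  set q := m + h • (dirac z - dirac y) with hq
  have hqy : q y = m y - h := by simp [hq, dirac_apply, hyz, sub_eq_add_neg]
  have hqz : q z = m z + h := by simp [hq, dirac_apply, hyz.symm]
  have hqj : ∀ j, j ≠ y → j ≠ z → q j = m j := fun j h1 h2 => by simp [hq, dirac_apply, h1, h2]
  have hqmem : q ∈ simplex d := by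
    refine ⟨fun j => ?_, ?_⟩
    · by_cases h1 : j = y
      · subst h1; rw [hqy]; linarith [hm'.1 j]
      by_cases h2 : j = z
      · subst h2; rw [hqz]; linarith [hm.1 j]
      rw [hqj j h1 h2]; exact hm.1 j
    · simp [hq, Finset.sum_add_distrib, Finset.sum_sub_distrib, ← Finset.mul_sum, hm.2,
        dirac_apply]
  have hcard : (Finset.univ.filter fun j => q j ≠ m' j).card < n := by
    rw [← hn]
    refine Finset.card_lt_card (Finset.ssubset_iff_of_subset ?_ |>.2 ?_)
    · intro j hj
      simp only [Finset.mem_filter, Finset.mem_univ, true_and] at hj ⊢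
      by_cases h1 : j = y
      · subst h1; exact hy.ne'
      by_cases h2 : j = z
      · subst h2; exact hz.ne
      rwa [hqj j h1 h2] at hj
    · rcases min_choice (m y - m' y) (m' z - m z) with hc | hc
      · exact ⟨y, by simpa using hy.ne', by simp [hqy, hh, hc]⟩
      · exact ⟨z, by simpa using hz.ne, by simp [hqz, hh, hc]⟩
  have h1 := ih _ hcard hqmem rfl
  have h2 := hf m hm y z h h0.le hqmem
  -- The `ℓ¹` distance really drops by `2h`; recording the drop at `y` alone is enough.
  have h3 : ∑ j, |q j - m' j| ≤ ∑ j, (|m j - m' j| - if j = y then h else 0) := by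
    refine Finset.sum_le_sum fun j _ => ?_
    by_cases h1 : j = y
    · subst h1
      rw [hqy, if_pos rfl, abs_of_nonneg (by linarith), abs_of_nonneg (by linarith)]
      linarith
    rw [if_neg h1]
    by_cases h2 : j = z
    · subst h2
      rw [hqz, abs_of_nonpos (by linarith), abs_of_nonpos (by linarith)]
      linarith
    rw [hqj j h1 h2, sub_zero]
  rw [Finset.sum_sub_distrib, Finset.sum_ite_eq' Finset.univ y, if_pos (Finset.mem_univ y)] at h3
  calc |f m - f m'| ≤ |f q - f m| + |f q - f m'| := by
        rw [abs_sub_comm (f q) (f m)]; exact abs_sub_le _ _ _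
    _ ≤ R * h + R * ∑ j, |q j - m' j| := add_le_add h2 h1
    _ ≤ R * h + R * (∑ j, |m j - m' j| - h) := by gcongr
    _ = _ := by ring

end FiniteMFG

/-! ### Finite differences and empirical measures -/

namespace FiniteMFG

variable {d : ℕ}

/-- The index is locally constant. This allows states, players and signs to join the compact space
of the maximum principle. -/
theorem continuousOn_of_discrete_index {ι Z : Type*} [TopologicalSpace ι] [DiscreteTopology ι]
    [TopologicalSpace Z] {p : Z → ι} (hp : Continuous p) {u : ι → Z → ℝ} {s : Set Z}
    (h : ∀ i, ContinuousOn (u i) s) : ContinuousOn (fun z => u (p z) z) s := by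
  intro z hz
  have hev : ∀ᶠ w in 𝓝[s] z, p w = p z :=
    mem_nhdsWithin_of_mem_nhds ((isOpen_discrete {p z}).preimage hp |>.mem_nhds rfl)
  refine (h (p z) z hz).congr_of_eventuallyEq ?_ rfl
  filter_upwards [hev] with w hw
  rw [hw]

theorem norm_diff_le {g : Fin d → ℝ} {b : ℝ} (hg : ∀ x, |g x| ≤ b) (x : Fin d) :
    ‖diff g x‖ ≤ √(d : ℝ) * (2 * b) := by
  have hb : 0 ≤ b := (abs_nonneg _).trans (hg x)
  refine norm_le_sqrt_mul _ (by positivity) fun y => ?_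
  simp only [diff]
  linarith [abs_sub (g y) (g x), hg x, hg y]

theorem norm_diffAt_le {N : ℕ} {g : (Fin N → Fin d) → ℝ} {b : ℝ} (hg : ∀ x, |g x| ≤ b)
    (j : Fin N) (x : Fin N → Fin d) : ‖diffAt j g x‖ ≤ √(d : ℝ) * (2 * b) := by
  have hb : 0 ≤ b := (abs_nonneg _).trans (hg x)
  refine norm_le_sqrt_mul _ (by positivity) fun y => ?_
  simp only [diffAt]
  linarith [abs_sub (g (Function.update x j y)) (g x), hg x, hg (Function.update x j y)]

section EmpiricalMeasures

variable {N : ℕ}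

theorem sum_mul_empiricalExcept (i : Fin N) (x : Fin N → Fin d) (g : Fin d → ℝ) :
    ∑ y, g y * empiricalExcept i x y =
      ((N : ℝ) - 1)⁻¹ * ∑ j ∈ Finset.univ.erase i, g (x j) := by
  simp only [empiricalExcept, PiLp.smul_apply, WithLp.ofLp_sum, Finset.sum_apply, smul_eq_mul,
    Finset.mul_sum, dirac_apply]
  rw [Finset.sum_comm]
  refine Finset.sum_congr rfl fun j _ => ?_
  simp [mul_comm]

theorem card_erase_cast (i : Fin N) : (((Finset.univ.erase i).card : ℕ) : ℝ) = (N : ℝ) - 1 := by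
  rw [Finset.card_erase_of_mem (Finset.mem_univ i), Finset.card_univ, Fintype.card_fin,
    Nat.cast_sub (by have := i.2; omega), Nat.cast_one]

theorem sub_one_pos_of_two_le (hN : 2 ≤ N) : 0 < (N : ℝ) - 1 := by
  have : (2 : ℝ) ≤ N := by exact_mod_cast hN
  linarith

theorem empiricalExcept_mem_simplex (hN : 2 ≤ N) (i : Fin N) (x : Fin N → Fin d) :
    empiricalExcept i x ∈ simplex d := by
  have h1 := sub_one_pos_of_two_le hN
  refine ⟨fun k => ?_, ?_⟩
  · simp only [empiricalExcept, PiLp.smul_apply, WithLp.ofLp_sum, Finset.sum_apply, smul_eq_mul]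
    exact mul_nonneg (inv_nonneg.2 h1.le)
      (Finset.sum_nonneg fun j _ => (dirac_mem_simplex (x j)).1 k)
  · have := sum_mul_empiricalExcept i x fun _ => 1
    simp only [one_mul, Finset.sum_const, nsmul_eq_mul, mul_one, card_erase_cast] at this
    rw [this, inv_mul_cancel₀ h1.ne']

theorem empirical_eq (hN : 2 ≤ N) (i : Fin N) (x : Fin N → Fin d) :
    empirical x =
      (N : ℝ)⁻¹ • dirac (x i) + (((N : ℝ) - 1) / N) • empiricalExcept i x := by
  have h1 := sub_one_pos_of_two_le hN
  rw [empirical, empiricalExcept, smul_smul, ← Finset.add_sum_erase _ _ (Finset.mem_univ i),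
    smul_add]
  congr 2
  field_simp

theorem empirical_mem_simplex (hN : 2 ≤ N) (x : Fin N → Fin d) : empirical x ∈ simplex d := by
  have h1 := sub_one_pos_of_two_le hN
  have h2 : (0 : ℝ) < N := by linarith
  rw [empirical_eq hN ⟨0, by omega⟩]
  refine convex_simplex (dirac_mem_simplex _) (empiricalExcept_mem_simplex hN _ _) (by positivity)
    (by positivity) ?_
  field_simp
  ring

theorem sum_abs_sub_le_two {m m' : Vec d} (hm : m ∈ simplex d) (hm' : m' ∈ simplex d) :
    ∑ k, |m k - m' k| ≤ 2 :=
  calc ∑ k, |m k - m' k| ≤ ∑ k, (m k + m' k) := Finset.sum_le_sum fun k _ => by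
        rw [abs_le]; constructor <;> linarith [hm.1 k, hm'.1 k]
    _ = 2 := by rw [Finset.sum_add_distrib, hm.2, hm'.2]; norm_num

theorem sum_abs_empirical_sub_le (hN : 2 ≤ N) (i : Fin N) (x : Fin N → Fin d) :
    ∑ k, |empiricalExcept i x k - empirical x k| ≤ 2 / N := by
  have h1 := sub_one_pos_of_two_le hN
  have h2 : (0 : ℝ) < N := by linarith
  have h3 : ∀ k, |empiricalExcept i x k - empirical x k| =
      (N : ℝ)⁻¹ * |empiricalExcept i x k - dirac (x i) k| := fun k => by
    rw [empirical_eq hN i, ← abs_of_pos (inv_pos.2 h2), ← abs_mul, abs_of_pos (inv_pos.2 h2)]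
    congr 1
    simp only [PiLp.add_apply, PiLp.smul_apply, smul_eq_mul]
    field_simp
    ring
  rw [Finset.sum_congr rfl fun k _ => h3 k, ← Finset.mul_sum, div_eq_inv_mul]
  gcongr
  exact sum_abs_sub_le_two (empiricalExcept_mem_simplex hN i x) (dirac_mem_simplex _)

theorem empiricalExcept_update_self (i : Fin N) (x : Fin N → Fin d) (z : Fin d) :
    empiricalExcept i (Function.update x i z) = empiricalExcept i x := by
  rw [empiricalExcept, empiricalExcept]
  congr 1
  refine Finset.sum_congr rfl fun j hj => ?_
  rw [Function.update_of_ne (Finset.ne_of_mem_erase hj)]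

/-- Jumps of other players are elementary moves of mass, so differences of `playerValue` are
increments controlled by the simplex derivative. -/
theorem empiricalExcept_update {i j : Fin N} (hij : j ≠ i) (x : Fin N → Fin d) (z : Fin d) :
    empiricalExcept i (Function.update x j z) =
      empiricalExcept i x + ((N : ℝ) - 1)⁻¹ • (dirac z - dirac (x j)) := by
  have hj : j ∈ Finset.univ.erase i := Finset.mem_erase.2 ⟨hij, Finset.mem_univ j⟩
  rw [empiricalExcept, empiricalExcept, ← smul_add, ← Finset.add_sum_erase _ _ hj,
    ← Finset.add_sum_erase _ _ hj, Function.update_self]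
  rw [Finset.sum_congr rfl fun k hk => by rw [Function.update_of_ne (Finset.ne_of_mem_erase hk)]]
  congr 1
  abel

theorem empiricalExcept_eq_add (i j : Fin N) (x : Fin N → Fin d) :
    empiricalExcept j x =
      empiricalExcept i x + ((N : ℝ) - 1)⁻¹ • (dirac (x i) - dirac (x j)) := by
  have h : ∀ k, ∑ l ∈ Finset.univ.erase k, dirac (x l) = ∑ l, dirac (x l) - dirac (x k) :=
    fun k => by rw [← Finset.add_sum_erase _ _ (Finset.mem_univ k), add_sub_cancel_left]
  rw [empiricalExcept, empiricalExcept, h, h, ← smul_add]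
  congr 1
  abel

end EmpiricalMeasures

/-! ### A priori bounds for the Master Equation and the game -/

namespace Game

variable (𝓖 : Game d)

/-- Bounds on the data that are compatible with the radius of the Lipschitz condition. -/
theorem LargeRadius.exists_bounds {𝓖 : Game d} {K : ℝ} (hK : 𝓖.LargeRadius K) (hd : 0 < d) :
    ∃ g c : ℝ, 0 ≤ g ∧ 0 ≤ c ∧ (∀ x, ∀ m ∈ simplex d, |𝓖.G x m| ≤ g) ∧
      (∀ x, ∀ a ∈ 𝓖.A, ∀ m ∈ simplex d, |𝓖.L x a| + |𝓖.F x m| ≤ c) ∧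
      √(d : ℝ) * (2 * (g + 𝓖.T * c)) ≤ K := by
  have hT := 𝓖.T_pos
  have hs : 0 < 2 * √(d : ℝ) := by positivity
  let x₀ : Fin d := ⟨0, hd⟩
  have hne : Nonempty (Fin d × simplex d) := ⟨(x₀, ⟨dirac x₀, dirac_mem_simplex x₀⟩)⟩
  have hkey : ∀ x y z : Fin d, ∀ a ∈ 𝓖.A, ∀ m ∈ simplex d, ∀ m' ∈ simplex d,
      |𝓖.G x m| + 𝓖.T * (|𝓖.L y a| + |𝓖.F z m'|) ≤ K / (2 * √(d : ℝ)) :=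
    fun x y z a ha m hm m' hm' => by
      rw [le_div_iff₀ hs, mul_comm]
      exact hK x y z a ha m hm m' hm'
  have ha₀ := 𝓖.αStar_mem x₀ 0
  -- With `g` the exact supremum of `|G|`, the rest of the budget `K / (2√d)`, divided by `T`,
  -- bounds `|L| + |F|`; the last inequality of the statement becomes an equality.
  set g : ℝ := ⨆ q : Fin d × simplex d, |𝓖.G q.1 q.2| with hg
  have hbdd : BddAbove (range fun q : Fin d × simplex d => |𝓖.G q.1 q.2|) := by
    refine ⟨K / (2 * √(d : ℝ)), ?_⟩
    rintro _ ⟨q, rfl⟩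
    refine le_trans ?_ (hkey q.1 x₀ x₀ _ ha₀ q.2 q.2.2 q.2 q.2.2)
    exact le_add_of_nonneg_right (by positivity)
  have hG : ∀ x, ∀ m ∈ simplex d, |𝓖.G x m| ≤ g := fun x m hm => le_ciSup hbdd (x, ⟨m, hm⟩)
  have hLF : ∀ x, ∀ a ∈ 𝓖.A, ∀ m ∈ simplex d,
      |𝓖.L x a| + |𝓖.F x m| ≤ (K / (2 * √(d : ℝ)) - g) / 𝓖.T := fun x a ha m hm => by
    rw [le_div_iff₀ hT, mul_comm, le_sub_comm]
    refine ciSup_le fun q => ?_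
    rw [le_sub_iff_add_le]
    exact hkey _ _ _ a ha _ q.2.2 m hm
  refine ⟨g, _, Real.iSup_nonneg fun q => abs_nonneg _, ?_, hG, hLF, ?_⟩
  · exact le_trans (by positivity) (hLF x₀ _ ha₀ _ (dirac_mem_simplex x₀))
  · rw [mul_div_cancel₀ _ hT.ne']
    apply le_of_eq
    field_simp
    ring

variable {𝓖}

section MasterEquation

variable {U Ut : ℝ → Fin d → Vec d → ℝ} {D : ℝ → Fin d → Vec d → Fin d → Vec d}

theorem IsClassicalSolution.continuousOn (hU : 𝓖.IsClassicalSolution U Ut D) {t : ℝ}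
    (ht : t ∈ Icc 0 𝓖.T) (x : Fin d) : ContinuousOn (U t x) (simplex d) :=
  (hU.cont x).comp (f := fun m => (t, m)) (by fun_prop) fun _ hm => ⟨ht, hm⟩

/-- Inserting the maximizer into `H` leaves linear transport with nonnegative controls plus a
running cost, so extrema can be treated by signs alone. -/
theorem IsClassicalSolution.neg_deriv_eq (hU : 𝓖.IsClassicalSolution U Ut D) {t : ℝ}
    (ht : t ∈ Icc 0 𝓖.T) (x : Fin d) {m : Vec d} (hm : m ∈ simplex d) :
    - Ut t x m = inner ℝ (𝓖.αStar x (diff (fun z => U t z m) x)) (diff (fun z => U t z m) x)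
      + ∑ y, inner ℝ (𝓖.αStar y (diff (fun z => U t z m) y)) (D t x m y) * m y
      + (𝓖.L x (𝓖.αStar x (diff (fun z => U t z m) x)) + 𝓖.F x m) := by
  have h := hU.equation t ht x m hm
  rw [H_eq] at h
  simp only [real_inner_comm (D t x m _)] at h ⊢
  linarith

/-- The factor `m y` removes exactly the states where maximality says nothing about the derivative.
-/
theorem drift_nonpos {f : Vec d → ℝ} {D : Vec d → Fin d → Vec d} (hf : IsSimplexDeriv f D)
    {m : Vec d} (hm : m ∈ simplex d) (hmax : ∀ m' ∈ simplex d, f m' ≤ f m) {a : Fin d → Vec d}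
    (ha : ∀ y z, 0 ≤ a y z) : ∑ y, inner ℝ (a y) (D m y) * m y ≤ 0 := by
  refine Finset.sum_nonpos fun y _ => ?_
  rcases (hm.1 y).eq_or_lt with h | h
  · rw [← h, mul_zero]
  · exact mul_nonpos_of_nonpos_of_nonneg
      (inner_nonpos_of_nonneg_of_nonpos (ha y) (hf.nonpos_of_isMaxOn hm hmax h)) h.le

/-- The a priori bound for the solution of the Master Equation. -/
theorem IsClassicalSolution.abs_apply_le (hU : 𝓖.IsClassicalSolution U Ut D) {g c : ℝ} (hc : 0 ≤ c)
    (hG : ∀ x, ∀ m ∈ simplex d, |𝓖.G x m| ≤ g)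
    (hLF : ∀ x, ∀ a ∈ 𝓖.A, ∀ m ∈ simplex d, |𝓖.L x a| + |𝓖.F x m| ≤ c)
    {t : ℝ} (ht : t ∈ Icc 0 𝓖.T) (x : Fin d) {m : Vec d} (hm : m ∈ simplex d) :
    |U t x m| ≤ g + 𝓖.T * c := by
  have hS : IsCompact ((univ : Set (Fin d)) ×ˢ simplex d) := isCompact_univ.prod isCompact_simplex
  have hcont : ContinuousOn (fun q : ℝ × Fin d × Vec d => U q.1 q.2.1 q.2.2)
      (Icc 0 𝓖.T ×ˢ univ ×ˢ simplex d) :=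
    continuousOn_of_discrete_index (p := fun q : ℝ × Fin d × Vec d => q.2.1) (by fun_prop)
      (u := fun x q => U q.1 x q.2.2)
      fun x => (hU.cont x).comp (f := fun q : ℝ × Fin d × Vec d => (q.1, q.2.2)) (by fun_prop)
        fun q hq => ⟨hq.1, hq.2.2⟩
  have hsum : ∀ t x, ∀ m ∈ simplex d,
      |𝓖.L x (𝓖.αStar x (diff (fun z => U t z m) x)) + 𝓖.F x m| ≤ c := fun t x m hm =>
    (abs_add_le _ _).trans (hLF x _ (𝓖.αStar_mem _ _) m hm)
  rw [abs_le']
  constructor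
  · refine le_add_mul_of_deriv_at_max (f := fun t q => U t q.1 q.2) hS hc hcont
      (fun q hq => hU.terminal q.1 q.2 hq.2 ▸ (le_abs_self _).trans (hG q.1 q.2 hq.2))
      (fun s hs q hq hmax => ⟨_, hU.deriv_time q.1 q.2 hq.2 s hs, ?_⟩) t ht (x, m) ⟨mem_univ _, hm⟩
    rw [hU.neg_deriv_eq hs q.1 hq.2]
    have h1 := inner_nonpos_of_nonneg_of_nonpos
      (𝓖.αStar_nonneg q.1 (diff (fun z => U s z q.2) q.1)) (p := diff (fun z => U s z q.2) q.1)
      fun y => sub_nonpos.2 (hmax (y, q.2) ⟨mem_univ _, hq.2⟩)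
    have h2 := drift_nonpos (hU.deriv_measure s hs q.1) hq.2
      (fun m' hm' => hmax (q.1, m') ⟨mem_univ _, hm'⟩)
      fun y => 𝓖.αStar_nonneg y (diff (fun z => U s z q.2) y)
    linarith [(abs_le.1 (hsum s q.1 q.2 hq.2)).2]
  · refine le_add_mul_of_deriv_at_max (f := fun t q => - U t q.1 q.2) hS hc hcont.neg
      (fun q hq => hU.terminal q.1 q.2 hq.2 ▸ (neg_le_abs _).trans (hG q.1 q.2 hq.2))
      (fun s hs q hq hmax => ⟨_, (hU.deriv_time q.1 q.2 hq.2 s hs).neg, ?_⟩)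
      t ht (x, m) ⟨mem_univ _, hm⟩
    rw [hU.neg_deriv_eq hs q.1 hq.2]
    have h1 := inner_nonneg_of_nonneg_of_nonneg
      (𝓖.αStar_nonneg q.1 (diff (fun z => U s z q.2) q.1)) (p := diff (fun z => U s z q.2) q.1)
      fun y => sub_nonneg.2 (neg_le_neg_iff.1 (hmax (y, q.2) ⟨mem_univ _, hq.2⟩))
    have h2 := drift_nonpos (hU.deriv_measure s hs q.1).neg hq.2
      (fun m' hm' => hmax (q.1, m') ⟨mem_univ _, hm'⟩)
      fun y => 𝓖.αStar_nonneg y (diff (fun z => U s z q.2) y)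
    simp only [inner_neg_right, neg_mul, Finset.sum_neg_distrib] at h2
    linarith [(abs_le.1 (hsum s q.1 q.2 hq.2)).1]

end MasterEquation

section HJB

variable {N : ℕ} {v : Fin N → ℝ → (Fin N → Fin d) → ℝ}

theorem IsHJBSolution.continuousOn (hv : 𝓖.IsHJBSolution v) (i : Fin N) (x : Fin N → Fin d) :
    ContinuousOn (fun t => v i t x) (Icc 0 𝓖.T) := fun t ht =>
  let ⟨_, h, _⟩ := hv.1 i x t ht
  h.continuousWithinAt

/-- Once `H` is written through its maximizer, player `i` enters the transport sum like every other
player. -/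
theorem IsHJBSolution.exists_deriv (hv : 𝓖.IsHJBSolution v) (i : Fin N) (x : Fin N → Fin d)
    {t : ℝ} (ht : t ∈ Icc 0 𝓖.T) :
    ∃ v', HasDerivWithinAt (fun s => v i s x) v' (Icc 0 𝓖.T) t ∧
      - v' = ∑ j, inner ℝ (𝓖.αStar (x j) (diffAt j (v j t) x)) (diffAt j (v i t) x)
        + (𝓖.L (x i) (𝓖.αStar (x i) (diffAt i (v i t) x))
          + 𝓖.F (x i) (empiricalExcept i x)) := by
  obtain ⟨v', hd, h⟩ := hv.1 i x t ht
  refine ⟨v', hd, ?_⟩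
  rw [H_eq] at h
  rw [← Finset.add_sum_erase _ _ (Finset.mem_univ i)]
  linarith

/-- The a priori bound for the value functions of the game with `N` players. -/
theorem IsHJBSolution.abs_apply_le (hN : 2 ≤ N) (hv : 𝓖.IsHJBSolution v) {g c : ℝ} (hc : 0 ≤ c)
    (hG : ∀ x, ∀ m ∈ simplex d, |𝓖.G x m| ≤ g)
    (hLF : ∀ x, ∀ a ∈ 𝓖.A, ∀ m ∈ simplex d, |𝓖.L x a| + |𝓖.F x m| ≤ c)
    {t : ℝ} (ht : t ∈ Icc 0 𝓖.T) (i : Fin N) (x : Fin N → Fin d) :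
    |v i t x| ≤ g + 𝓖.T * c := by
  have hS : IsCompact (univ : Set (Fin N → Fin d)) := isCompact_univ
  have hcont : ContinuousOn (fun q : ℝ × (Fin N → Fin d) => v i q.1 q.2) (Icc 0 𝓖.T ×ˢ univ) :=
    continuousOn_of_discrete_index (p := fun q : ℝ × (Fin N → Fin d) => q.2) (by fun_prop)
      (u := fun x q => v i q.1 x)
      fun x => (hv.continuousOn i x).comp (f := fun q : ℝ × (Fin N → Fin d) => q.1)
        (by fun_prop) fun q hq => hq.1
  have hsum : ∀ a x, a ∈ 𝓖.A → |𝓖.L (x i) a + 𝓖.F (x i) (empiricalExcept i x)| ≤ c :=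
    fun a x ha => (abs_add_le _ _).trans (hLF _ _ ha _ (empiricalExcept_mem_simplex hN i x))
  rw [abs_le']
  constructor
  · refine le_add_mul_of_deriv_at_max (f := v i) hS hc hcont
      (fun q _ => hv.2 i q ▸ (le_abs_self _).trans (hG _ _ (empiricalExcept_mem_simplex hN i q)))
      (fun s hs q _ hmax => ?_) t ht x (mem_univ _)
    obtain ⟨v', hd, h⟩ := hv.exists_deriv i q hs
    refine ⟨v', hd, h ▸ ?_⟩
    have h1 : ∑ j, inner ℝ (𝓖.αStar (q j) (diffAt j (v j s) q)) (diffAt j (v i s) q) ≤ 0 :=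
      Finset.sum_nonpos fun j _ => inner_nonpos_of_nonneg_of_nonpos (𝓖.αStar_nonneg _ _)
        fun y => sub_nonpos.2 (hmax _ (mem_univ _))
    linarith [(abs_le.1 (hsum _ q (𝓖.αStar_mem (q i) (diffAt i (v i s) q)))).2]
  · refine le_add_mul_of_deriv_at_max (f := fun t q => - v i t q) hS hc hcont.neg
      (fun q _ => hv.2 i q ▸ (neg_le_abs _).trans (hG _ _ (empiricalExcept_mem_simplex hN i q)))
      (fun s hs q _ hmax => ?_) t ht x (mem_univ _)
    obtain ⟨v', hd, h⟩ := hv.exists_deriv i q hs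
    refine ⟨-v', hd.neg, ?_⟩
    rw [h]
    have h1 : 0 ≤ ∑ j, inner ℝ (𝓖.αStar (q j) (diffAt j (v j s) q)) (diffAt j (v i s) q) :=
      Finset.sum_nonneg fun j _ => inner_nonneg_of_nonneg_of_nonneg (𝓖.αStar_nonneg _ _)
        fun y => sub_nonneg.2 (neg_le_neg_iff.1 (hmax _ (mem_univ _)))
    linarith [(abs_le.1 (hsum _ q (𝓖.αStar_mem (q i) (diffAt i (v i s) q)))).1]

end HJB

end Game

end FiniteMFG

/-! ### Estimates uniform in the number of players -/

namespace FiniteMFG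

variable {d : ℕ}

namespace Game

variable {𝓖 : Game d}

theorem norm_αStar_le (x : Fin d) (p : Vec d) : ‖𝓖.αStar x p‖ ≤ √(d : ℝ) * 𝓖.M := by
  refine norm_le_sqrt_mul _ (𝓖.κ_pos.le.trans 𝓖.κ_le_M) fun y => ?_
  rw [abs_of_nonneg (𝓖.αStar_nonneg x p y)]
  exact (𝓖.αStar_mem x p y).2

theorem H1.exists_uniform {K : ℝ} (h : 𝓖.H1 K) :
    ∃ C : ℝ≥0, ∀ x, LipschitzOnWith C (𝓖.H x) (Metric.closedBall 0 K) ∧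
      LipschitzOnWith C (𝓖.αStar x) (Metric.closedBall 0 K) := by
  choose C₁ h₁ using fun x => (h x).1
  choose C₂ h₂ using fun x => (h x).2
  refine ⟨Finset.univ.sup (fun x => C₁ x ⊔ C₂ x), fun x => ⟨?_, ?_⟩⟩
  · exact (h₁ x).weaken (le_sup_left.trans (Finset.le_sup (f := fun x => C₁ x ⊔ C₂ x)
      (Finset.mem_univ x)))
  · exact (h₂ x).weaken (le_sup_right.trans (Finset.le_sup (f := fun x => C₁ x ⊔ C₂ x)
      (Finset.mem_univ x)))

/-- The quantitative regularity of the data and of a solution of the Master Equation: `B` bounds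
the solution, `R` its derivatives in the measure of first and second order, and `C` is a Lipschitz
constant of the Hamiltonian and of its maximizer on the relevant ball. -/
structure Estimates (𝓖 : Game d) (U : ℝ → Fin d → Vec d → ℝ)
    (D : ℝ → Fin d → Vec d → Fin d → Vec d) (B R C : ℝ) : Prop where
  B_nonneg : 0 ≤ B
  R_nonneg : 0 ≤ R
  C_nonneg : 0 ≤ C
  abs_le : ∀ t ∈ Icc 0 𝓖.T, ∀ x, ∀ m ∈ simplex d, |U t x m| ≤ B
  abs_deriv_le : ∀ t ∈ Icc 0 𝓖.T, ∀ x, ∀ m ∈ simplex d, ∀ y z, |D t x m y z| ≤ R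
  abs_move_le : ∀ t ∈ Icc 0 𝓖.T, ∀ x, ∀ m ∈ simplex d, ∀ (y z : Fin d) (h : ℝ), 0 ≤ h →
    m + h • (dirac z - dirac y) ∈ simplex d →
    |U t x (m + h • (dirac z - dirac y)) - U t x m| ≤ R * h
  abs_taylor_le : ∀ t ∈ Icc 0 𝓖.T, ∀ x, ∀ m ∈ simplex d, ∀ (y z : Fin d) (h : ℝ), 0 ≤ h →
    m + h • (dirac z - dirac y) ∈ simplex d →
    |U t x (m + h • (dirac z - dirac y)) - U t x m - h * D t x m y z| ≤ R * h * h
  lip_H : ∀ x p q, ‖p‖ ≤ √(d : ℝ) * (2 * B) → ‖q‖ ≤ √(d : ℝ) * (2 * B) →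
    |𝓖.H x p - 𝓖.H x q| ≤ C * ‖p - q‖
  lip_αStar : ∀ x p q, ‖p‖ ≤ √(d : ℝ) * (2 * B) → ‖q‖ ≤ √(d : ℝ) * (2 * B) →
    ‖𝓖.αStar x p - 𝓖.αStar x q‖ ≤ C * ‖p - q‖

theorem IsClassicalSolution.exists_estimates {U Ut : ℝ → Fin d → Vec d → ℝ}
    {D : ℝ → Fin d → Vec d → Fin d → Vec d} (hU : 𝓖.IsClassicalSolution U Ut D) {C₀ : ℝ≥0}
    (hD : ∀ t ∈ Icc 0 𝓖.T, ∀ x y, LipschitzOnWith C₀ (fun m => D t x m y) (simplex d))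
    {K : ℝ} (hK : 𝓖.LargeRadius K) (hH1 : 𝓖.H1 K) (hd : 0 < d) :
    ∃ B R C, 𝓖.Estimates U D B R C ∧
      ∀ N, 2 ≤ N → ∀ v : Fin N → ℝ → (Fin N → Fin d) → ℝ, 𝓖.IsHJBSolution v →
        ∀ t ∈ Icc 0 𝓖.T, ∀ i x, |v i t x| ≤ B := by
  obtain ⟨g, c, hg, hc, hG, hLF, hgK⟩ := hK.exists_bounds hd
  obtain ⟨C, hC⟩ := hH1.exists_uniform
  set B := g + 𝓖.T * c with hBdef
  have hB0 : 0 ≤ B := add_nonneg hg (mul_nonneg 𝓖.T_pos.le hc)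
  have hB : ∀ t ∈ Icc 0 𝓖.T, ∀ x, ∀ m ∈ simplex d, |U t x m| ≤ B :=
    fun t ht x m hm => hU.abs_apply_le hc hG hLF ht x hm
  have hR : ∀ t ∈ Icc 0 𝓖.T, ∀ x, ∀ m ∈ simplex d, ∀ y z, |D t x m y z| ≤ 2 * B + 4 * C₀ :=
    fun t ht x m hm y z => (hU.deriv_measure t ht x).abs_deriv_le (hU.continuousOn ht x)
      (hD t ht x) (hB t ht x) hm y z
  have hC₀ : (0 : ℝ) ≤ C₀ := C₀.2
  have hball : ∀ p : Vec d, ‖p‖ ≤ √(d : ℝ) * (2 * B) → p ∈ Metric.closedBall 0 K :=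
    fun p hp => by simpa using hp.trans hgK
  -- The derivative bound also dominates the Taylor constant `2 * C₀`, so one `R` serves both
  -- orders; `hgK` puts the relevant differences inside the ball of `hH1`.
  refine ⟨B, 2 * B + 4 * C₀, C, ⟨hB0, by positivity, C.2, hB, hR, ?_, ?_, ?_, ?_⟩, ?_⟩
  · exact fun t ht x m hm y z h h0 hh => (hU.deriv_measure t ht x).abs_move_le
      (hU.continuousOn ht x) (hR t ht x) hm h0 hh
  · refine fun t ht x m hm y z h h0 hh => ((hU.deriv_measure t ht x).abs_taylor_le
      (hU.continuousOn ht x) (hD t ht x) hm h0 hh).trans ?_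
    gcongr
    linarith
  · intro x p q hp hq
    simpa [dist_eq_norm] using (hC x).1.dist_le_mul p (hball p hp) q (hball q hq)
  · intro x p q hp hq
    simpa [dist_eq_norm] using (hC x).2.dist_le_mul p (hball p hp) q (hball q hq)
  · exact fun N hN v hv t ht i x => hv.abs_apply_le hN hc hG hLF ht i x

end Game

/-- The value of player `i` as predicted by a solution `U` of the Master Equation. -/
noncomputable def playerValue {N : ℕ} (U : ℝ → Fin d → Vec d → ℝ) (i : Fin N) (t : ℝ)
    (x : Fin N → Fin d) : ℝ :=
  U t (x i) (empiricalExcept i x)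

/-- A player's own jump does not change the measure it sees, so the Hamiltonian terms match without
error. -/
theorem diffAt_playerValue_self {N : ℕ} (U : ℝ → Fin d → Vec d → ℝ) (i : Fin N) (t : ℝ)
    (x : Fin N → Fin d) :
    diffAt i (playerValue U i t) x = diff (fun z => U t z (empiricalExcept i x)) (x i) := by
  simp only [diffAt, diff, playerValue, empiricalExcept_update_self, Function.update_self]

theorem diffAt_sub {N : ℕ} (j : Fin N) (g h : (Fin N → Fin d) → ℝ) (x : Fin N → Fin d) :
    diffAt j g x - diffAt j h x = diffAt j (fun y => g y - h y) x := by
  ext y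
  simp only [diffAt, PiLp.sub_apply]
  ring

/-! ### Consistency error and comparison -/

namespace Game.Estimates

variable {𝓖 : Game d} {U : ℝ → Fin d → Vec d → ℝ} {D : ℝ → Fin d → Vec d → Fin d → Vec d}
  {B R C : ℝ} {N : ℕ} {t : ℝ}

theorem abs_sub_le_sum (hE : 𝓖.Estimates U D B R C)
    (ht : t ∈ Icc 0 𝓖.T) (x : Fin d) {m m' : Vec d} (hm : m ∈ simplex d)
    (hm' : m' ∈ simplex d) : |U t x m - U t x m'| ≤ R * ∑ k, |m k - m' k| :=
  abs_sub_le_sum_of_move (hE.abs_move_le t ht x) hE.R_nonneg hm hm'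

theorem norm_diff_le (hE : 𝓖.Estimates U D B R C)
    (ht : t ∈ Icc 0 𝓖.T) {m : Vec d} (hm : m ∈ simplex d) (x : Fin d) :
    ‖diff (fun z => U t z m) x‖ ≤ √(d : ℝ) * (2 * B) :=
  FiniteMFG.norm_diff_le (fun z => hE.abs_le t ht z m hm) x

theorem norm_diffAt_playerValue_le (hE : 𝓖.Estimates U D B R C)
    (hN : 2 ≤ N) (ht : t ∈ Icc 0 𝓖.T) {i j : Fin N} (hij : j ≠ i)
    (x : Fin N → Fin d) :
    ‖diffAt j (playerValue U i t) x‖ ≤ √(d : ℝ) * (R * ((N : ℝ) - 1)⁻¹) := by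
  have h1 := sub_one_pos_of_two_le hN
  have hR := hE.R_nonneg
  refine norm_le_sqrt_mul _ (by positivity) fun z => ?_
  simp only [diffAt, playerValue, Function.update_of_ne hij.symm]
  have h := empiricalExcept_mem_simplex hN i (Function.update x j z)
  rw [empiricalExcept_update hij] at h ⊢
  exact hE.abs_move_le t ht _ _ (empiricalExcept_mem_simplex hN i x) _ _ _ (inv_nonneg.2 h1.le) h

theorem norm_smul_deriv_sub_diffAt_le (hE : 𝓖.Estimates U D B R C)
    (hN : 2 ≤ N) (ht : t ∈ Icc 0 𝓖.T) {i j : Fin N}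
    (hij : j ≠ i) (x : Fin N → Fin d) :
    ‖((N : ℝ) - 1)⁻¹ • D t (x i) (empiricalExcept i x) (x j) - diffAt j (playerValue U i t) x‖ ≤
      √(d : ℝ) * (R * ((N : ℝ) - 1)⁻¹ * ((N : ℝ) - 1)⁻¹) := by
  have h1 := sub_one_pos_of_two_le hN
  have hR := hE.R_nonneg
  refine norm_le_sqrt_mul _ (by positivity) fun z => ?_
  simp only [diffAt, playerValue, Function.update_of_ne hij.symm, PiLp.sub_apply, PiLp.smul_apply,
    smul_eq_mul]
  have h := empiricalExcept_mem_simplex hN i (Function.update x j z)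
  rw [empiricalExcept_update hij] at h ⊢
  rw [abs_sub_comm]
  exact hE.abs_taylor_le t ht _ _ (empiricalExcept_mem_simplex hN i x) _ _ _
    (inv_nonneg.2 h1.le) h

/-- The Master Equation evaluates player `j`'s control at the measure seen by `i`, the game at the
one seen by `j`; these differ by a move of mass `1/(N-1)`. -/
theorem norm_αStar_sub_le (hE : 𝓖.Estimates U D B R C)
    (hN : 2 ≤ N) (ht : t ∈ Icc 0 𝓖.T) (i j : Fin N)
    (x : Fin N → Fin d) :
    ‖𝓖.αStar (x j) (diff (fun z => U t z (empiricalExcept i x)) (x j)) -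
        𝓖.αStar (x j) (diffAt j (playerValue U j t) x)‖ ≤
      C * (√(d : ℝ) * (2 * (R * ((N : ℝ) - 1)⁻¹))) := by
  have h1 := sub_one_pos_of_two_le hN
  have hi := empiricalExcept_mem_simplex hN i x
  have hj := empiricalExcept_mem_simplex hN j x
  have hsub : ∀ z, |U t z (empiricalExcept i x) - U t z (empiricalExcept j x)| ≤
      R * ((N : ℝ) - 1)⁻¹ := fun z => by
    rw [abs_sub_comm, empiricalExcept_eq_add i j x]
    rw [empiricalExcept_eq_add i j x] at hj
    exact hE.abs_move_le t ht z _ hi _ _ _ (inv_nonneg.2 h1.le) hj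
  rw [diffAt_playerValue_self]
  refine (hE.lip_αStar _ _ _ (hE.norm_diff_le ht hi _) (hE.norm_diff_le ht hj _)).trans ?_
  refine mul_le_mul_of_nonneg_left ?_ hE.C_nonneg
  have : diff (fun z => U t z (empiricalExcept i x)) (x j)
      - diff (fun z => U t z (empiricalExcept j x)) (x j) =
      diff (fun z => U t z (empiricalExcept i x) - U t z (empiricalExcept j x)) (x j) := by
    ext y
    simp only [diff, PiLp.sub_apply]
    ring
  rw [this]
  exact FiniteMFG.norm_diff_le hsub _

/-- The transport term of the Master Equation at an empirical measure is close to the one of the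
system of the `N`-player game. -/
theorem abs_transport_sub_le (hE : 𝓖.Estimates U D B R C)
    (hN : 2 ≤ N) (ht : t ∈ Icc 0 𝓖.T) (i : Fin N) (x : Fin N → Fin d) :
    |∑ y, inner ℝ (D t (x i) (empiricalExcept i x) y)
          (𝓖.αStar y (diff (fun z => U t z (empiricalExcept i x)) y)) * empiricalExcept i x y
      - ∑ j ∈ Finset.univ.erase i, inner ℝ (𝓖.αStar (x j) (diffAt j (playerValue U j t) x))
          (diffAt j (playerValue U i t) x)| ≤
      (2 * C * R ^ 2 + 𝓖.M * R) * d * ((N : ℝ) - 1)⁻¹ := by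
  have h1 := sub_one_pos_of_two_le hN
  have hC := hE.C_nonneg
  have hR := hE.R_nonneg
  have hM : 0 ≤ 𝓖.M := 𝓖.κ_pos.le.trans 𝓖.κ_le_M
  have hi := empiricalExcept_mem_simplex hN i x
  rw [sum_mul_empiricalExcept i x fun y => inner ℝ (D t (x i) (empiricalExcept i x) y)
    (𝓖.αStar y (diff (fun z => U t z (empiricalExcept i x)) y)), Finset.mul_sum,
    ← Finset.sum_sub_distrib]
  set n := ((N : ℝ) - 1)⁻¹ with hn
  have hn0 : 0 ≤ n := inv_nonneg.2 h1.le
  have hterm : ∀ j ∈ Finset.univ.erase i,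
      |n * inner ℝ (D t (x i) (empiricalExcept i x) (x j))
          (𝓖.αStar (x j) (diff (fun z => U t z (empiricalExcept i x)) (x j)))
        - inner ℝ (𝓖.αStar (x j) (diffAt j (playerValue U j t) x))
          (diffAt j (playerValue U i t) x)| ≤ (2 * C * R ^ 2 + 𝓖.M * R) * d * n * n := by
    intro j hj
    have hij := Finset.ne_of_mem_erase hj
    have hα := hE.norm_αStar_sub_le hN ht i j x
    have hδ := hE.norm_smul_deriv_sub_diffAt_le hN ht hij x
    have hb := 𝓖.norm_αStar_le (x j) (diffAt j (playerValue U j t) x)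
    have hDn : ‖D t (x i) (empiricalExcept i x) (x j)‖ ≤ √(d : ℝ) * R :=
      norm_le_sqrt_mul _ hR fun z => hE.abs_deriv_le t ht _ _ hi _ z
    rw [← hn] at hα hδ
    generalize 𝓖.αStar (x j) (diff (fun z => U t z (empiricalExcept i x)) (x j)) = a at *
    generalize 𝓖.αStar (x j) (diffAt j (playerValue U j t) x) = b at *
    generalize D t (x i) (empiricalExcept i x) (x j) = p at *
    generalize diffAt j (playerValue U i t) x = q at *
    -- An `O(1/N)` control error meets an `O(1/N)` gradient, and a bounded control meets an
    -- `O(1/N²)` Taylor remainder, so each summand is `O(1/N²)`.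
    have hsplit : n * inner ℝ p a - inner ℝ b q =
        inner ℝ (a - b) (n • p) + inner ℝ b (n • p - q) := by
      rw [inner_sub_left, inner_sub_right, inner_smul_right, inner_smul_right, real_inner_comm p a]
      ring
    have hd : √(d : ℝ) * √(d : ℝ) = d := Real.mul_self_sqrt (Nat.cast_nonneg d)
    rw [hsplit]
    calc _ ≤ |inner ℝ (a - b) (n • p)| + |inner ℝ b (n • p - q)| := abs_add_le _ _
      _ ≤ ‖a - b‖ * ‖n • p‖ + ‖b‖ * ‖n • p - q‖ :=
        add_le_add (abs_real_inner_le_norm _ _) (abs_real_inner_le_norm _ _)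
      _ ≤ (C * (√(d : ℝ) * (2 * (R * n)))) * (n * (√(d : ℝ) * R)) +
          (√(d : ℝ) * 𝓖.M) * (√(d : ℝ) * (R * n * n)) := by
        rw [norm_smul, Real.norm_of_nonneg hn0]
        gcongr
      _ = (2 * C * R ^ 2 + 𝓖.M * R) * (√(d : ℝ) * √(d : ℝ)) * n * n := by ring
      _ = _ := by rw [hd]
  calc _ ≤ ∑ j ∈ Finset.univ.erase i, (2 * C * R ^ 2 + 𝓖.M * R) * d * n * n :=
        (Finset.abs_sum_le_sum_abs _ _).trans (Finset.sum_le_sum hterm)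
    _ = (2 * C * R ^ 2 + 𝓖.M * R) * d * n * (((N : ℝ) - 1) * n) := by
        rw [Finset.sum_const, nsmul_eq_mul, card_erase_cast]
        ring
    _ = _ := by rw [hn, mul_inv_cancel₀ h1.ne', mul_one]

/-- The comparison of the value functions with the solution of the Master Equation. -/
theorem abs_playerValue_sub_le (hE : 𝓖.Estimates U D B R C)
    (hN : 2 ≤ N) {Ut : ℝ → Fin d → Vec d → ℝ}
    (hU : 𝓖.IsClassicalSolution U Ut D) {v : Fin N → ℝ → (Fin N → Fin d) → ℝ}
    (hv : 𝓖.IsHJBSolution v) (hvB : ∀ t ∈ Icc 0 𝓖.T, ∀ i x, |v i t x| ≤ B)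
    (ht : t ∈ Icc 0 𝓖.T) (i : Fin N) (x : Fin N → Fin d) :
    |playerValue U i t x - v i t x| ≤
      (2 * C * R ^ 2 + 𝓖.M * R) * d * ((N : ℝ) - 1)⁻¹ *
        Real.exp ((2 * C * √(d : ℝ) + 2 * C * d * R + 1) * 𝓖.T) := by
  have h1 := sub_one_pos_of_two_le hN
  have hC := hE.C_nonneg
  have hR := hE.R_nonneg
  have hM : 0 ≤ 𝓖.M := 𝓖.κ_pos.le.trans 𝓖.κ_le_M
  set w : ℝ → Fin N → (Fin N → Fin d) → ℝ := fun t i x => playerValue U i t x - v i t x with hw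
  -- Including the sign and the player in the maximization makes the maximum bound every `|w s j y|`
  -- at once, which the coupled system requires.
  let σ : Bool → ℝ := fun b => if b then 1 else -1
  have hσ : ∀ b, |σ b| = 1 := by simp [σ]
  let f : ℝ → Bool × Fin N × (Fin N → Fin d) → ℝ := fun t q => σ q.1 * w t q.2.1 q.2.2
  have hmem := fun (i : Fin N) (x : Fin N → Fin d) => empiricalExcept_mem_simplex hN i x
  have hcont : ContinuousOn (fun q : ℝ × Bool × Fin N × (Fin N → Fin d) => f q.1 q.2)
      (Icc 0 𝓖.T ×ˢ univ) := by
    refine continuousOn_of_discrete_index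
      (p := fun q : ℝ × Bool × Fin N × (Fin N → Fin d) => q.2) (by fun_prop)
      (u := fun k q => f q.1 k) fun k => ?_
    refine ContinuousOn.comp (g := fun t => f t k) (t := Icc 0 𝓖.T) ?_ (by fun_prop)
      fun q hq => hq.1
    refine continuousOn_const.mul (ContinuousOn.sub ?_ (hv.continuousOn _ _))
    exact fun s hs => (hU.deriv_time _ _ (hmem k.2.1 k.2.2) s hs).continuousWithinAt
  have key := le_mul_exp_of_deriv_at_max (f := f) (T := 𝓖.T) (S := univ) isCompact_univ
    (c₀ := (2 * C * R ^ 2 + 𝓖.M * R) * d * ((N : ℝ) - 1)⁻¹)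
    (c₁ := 2 * C * √(d : ℝ) + 2 * C * d * R) (by positivity) (by positivity) hcont
    (fun q _ => by simp [f, w, playerValue, hU.terminal _ _ (hmem _ _), hv.2])
    (fun s hs q _ hmax => ?_)
  · rw [abs_le']
    have h2 := key t ht (true, i, x) (mem_univ _)
    have h3 := key t ht (false, i, x) (mem_univ _)
    simp only [f, σ, if_true, one_mul, Bool.false_eq_true, if_false, neg_one_mul] at h2 h3
    exact ⟨h2, h3⟩
  obtain ⟨b, i, x⟩ := q
  obtain ⟨v', hd', hv'⟩ := hv.1 i x s hs
  refine ⟨_, ((hU.deriv_time (x i) _ (hmem i x) s hs).sub hd').const_mul (σ b), ?_⟩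
  set ρ := f s (b, i, x) with hρ
  have hwρ : ∀ j y, |w s j y| ≤ ρ := fun j y => by
    have h2 := hmax (true, j, y) (mem_univ _)
    have h3 := hmax (false, j, y) (mem_univ _)
    simp only [f, σ, if_true, one_mul, Bool.false_eq_true, if_false, neg_one_mul] at h2 h3
    exact abs_le'.2 ⟨h2, h3⟩
  have hρ0 : 0 ≤ ρ := (abs_nonneg _).trans (hwρ i x)
  have hwn : ∀ j k : Fin N, ‖diffAt j (playerValue U k s) x - diffAt j (v k s) x‖ ≤
      √(d : ℝ) * (2 * ρ) := fun j k => by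
    rw [diffAt_sub]
    exact norm_diffAt_le (hwρ k) j x
  have hun : ∀ j : Fin N, ‖diffAt j (playerValue U j s) x‖ ≤ √(d : ℝ) * (2 * B) := fun j =>
    norm_diffAt_le (fun y => hE.abs_le s hs _ _ (hmem j y)) j x
  have hvn : ∀ j : Fin N, ‖diffAt j (v j s) x‖ ≤ √(d : ℝ) * (2 * B) := fun j =>
    norm_diffAt_le (fun y => hvB s hs j y) j x
  have hHam : |𝓖.H (x i) (diffAt i (playerValue U i s) x) - 𝓖.H (x i) (diffAt i (v i s) x)| ≤
      C * (√(d : ℝ) * (2 * ρ)) :=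
    (hE.lip_H _ _ _ (hun i) (hvn i)).trans (mul_le_mul_of_nonneg_left (hwn i i) hC)
  have htransport := hE.abs_transport_sub_le hN hs i x
  have heq := hU.equation s hs (x i) _ (hmem i x)
  -- Each of the `N - 1` control errors is multiplied by a difference of size `R/(N-1)`, which keeps
  -- the Gronwall rate independent of `N`.
  have hcontrol : |∑ j ∈ Finset.univ.erase i,
      inner ℝ (𝓖.αStar (x j) (diffAt j (playerValue U j s) x)
        - 𝓖.αStar (x j) (diffAt j (v j s) x)) (diffAt j (playerValue U i s) x)| ≤
      2 * C * d * R * ρ := by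
    have hd : √(d : ℝ) * √(d : ℝ) = d := Real.mul_self_sqrt (Nat.cast_nonneg d)
    calc _ ≤ ∑ j ∈ Finset.univ.erase i,
          (C * (√(d : ℝ) * (2 * ρ))) * (√(d : ℝ) * (R * ((N : ℝ) - 1)⁻¹)) := by
          refine (Finset.abs_sum_le_sum_abs _ _).trans (Finset.sum_le_sum fun j hj => ?_)
          refine (abs_real_inner_le_norm _ _).trans (mul_le_mul ?_
            (hE.norm_diffAt_playerValue_le hN hs (Finset.ne_of_mem_erase hj) x) (norm_nonneg _)
            (by positivity))
          exact (hE.lip_αStar _ _ _ (hun j) (hvn j)).trans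
            (mul_le_mul_of_nonneg_left (hwn j j) hC)
      _ = 2 * C * (√(d : ℝ) * √(d : ℝ)) * R * ρ * (((N : ℝ) - 1) * ((N : ℝ) - 1)⁻¹) := by
          rw [Finset.sum_const, nsmul_eq_mul, card_erase_cast]
          ring
      _ = _ := by rw [mul_inv_cancel₀ h1.ne', mul_one, hd]
  -- Norms would cost a factor `N` here; instead, maximality over configurations makes each summand
  -- nonpositive.
  have hdrift : σ b * ∑ j ∈ Finset.univ.erase i, inner ℝ (𝓖.αStar (x j) (diffAt j (v j s) x))
      (diffAt j (playerValue U i s) x - diffAt j (v i s) x) ≤ 0 := by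
    rw [Finset.mul_sum]
    refine Finset.sum_nonpos fun j _ => ?_
    rw [← inner_smul_right]
    refine inner_nonpos_of_nonneg_of_nonpos (𝓖.αStar_nonneg _ _) fun y => ?_
    have := hmax (b, i, Function.update x j y) (mem_univ _)
    rw [diffAt_sub]
    simp only [diffAt, PiLp.smul_apply, smul_eq_mul, mul_sub]
    simp only [f, w, mul_sub] at this
    linarith
  -- The control error is paired with the small difference of `playerValue`, and the difference of
  -- `w` with the controls of `v`, whose sign is known.
  have hsplit : -(Ut s (x i) (empiricalExcept i x) - v') =
      -(𝓖.H (x i) (diffAt i (playerValue U i s) x) - 𝓖.H (x i) (diffAt i (v i s) x))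
      + (∑ y, inner ℝ (D s (x i) (empiricalExcept i x) y)
          (𝓖.αStar y (diff (fun z => U s z (empiricalExcept i x)) y)) * empiricalExcept i x y
        - ∑ j ∈ Finset.univ.erase i, inner ℝ (𝓖.αStar (x j) (diffAt j (playerValue U j s) x))
          (diffAt j (playerValue U i s) x))
      + ∑ j ∈ Finset.univ.erase i, inner ℝ (𝓖.αStar (x j) (diffAt j (playerValue U j s) x)
        - 𝓖.αStar (x j) (diffAt j (v j s) x)) (diffAt j (playerValue U i s) x)
      + ∑ j ∈ Finset.univ.erase i, inner ℝ (𝓖.αStar (x j) (diffAt j (v j s) x))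
        (diffAt j (playerValue U i s) x - diffAt j (v i s) x) := by
    simp only [inner_sub_left, inner_sub_right, Finset.sum_sub_distrib]
    rw [diffAt_playerValue_self]
    linarith
  have hs1 : ∀ a r : ℝ, |a| ≤ r → σ b * a ≤ r := fun a r ha =>
    (le_abs_self _).trans (by rwa [abs_mul, hσ, one_mul])
  rw [← mul_neg, hsplit, mul_add, mul_add, mul_add]
  have e1 := hs1 _ _ ((abs_neg _).trans_le hHam)
  have e2 := hs1 _ _ htransport
  have e3 := hs1 _ _ hcontrol
  linarith

end Game.Estimates

end FiniteMFG

/-! ### Product laws and the law of large numbers -/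

namespace FiniteMFG

section ProductWeights

variable {ι α : Type*} [Fintype ι] [DecidableEq ι] [Fintype α] {p : ι → α → ℝ}

theorem sum_prod_eq_prod_sum (q : ι → α → ℝ) :
    ∑ y : ι → α, ∏ j, q j (y j) = ∏ j, ∑ a, q j a := by
  rw [Finset.prod_univ_sum, Fintype.piFinset_univ]

theorem sum_prod_eq_one (hp : ∀ j, ∑ a, p j a = 1) : ∑ y : ι → α, ∏ j, p j (y j) = 1 := by
  rw [sum_prod_eq_prod_sum]
  exact Finset.prod_eq_one fun j _ => hp j

/-- Independence: the sum factorizes over coordinates, and the factor at `j` is a centred mean. -/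
theorem sum_prod_mul_mul_eq_zero {g : ι → α → ℝ} {j l : ι} (hjl : j ≠ l)
    (hg : ∑ a, p j a * g j a = 0) :
    ∑ y : ι → α, (∏ k, p k (y k)) * (g j (y j) * g l (y l)) = 0 := by
  have h : ∀ y : ι → α, (∏ k, p k (y k)) * (g j (y j) * g l (y l)) =
      ∏ k, p k (y k) * ((if k = j then g k (y k) else 1) * (if k = l then g k (y k) else 1)) := by
    intro y
    rw [Finset.prod_mul_distrib, Finset.prod_mul_distrib, Finset.prod_ite_eq',
      Finset.prod_ite_eq', if_pos (Finset.mem_univ _), if_pos (Finset.mem_univ _)]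
  rw [Finset.sum_congr rfl fun y _ => h y, sum_prod_eq_prod_sum fun k a =>
    p k a * ((if k = j then g k a else 1) * (if k = l then g k a else 1))]
  refine Finset.prod_eq_zero (Finset.mem_univ j) ?_
  simpa [hjl] using hg

/-- The second moment of a sum of independent centred variables with values in `[-1, 1]`. -/
theorem sum_prod_mul_sq_le (hp0 : ∀ j a, 0 ≤ p j a) (hp : ∀ j, ∑ a, p j a = 1) (s : Finset ι)
    {g : ι → α → ℝ} (hg : ∀ j ∈ s, ∑ a, p j a * g j a = 0) (hg1 : ∀ j a, |g j a| ≤ 1) :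
    ∑ y : ι → α, (∏ k, p k (y k)) * (∑ j ∈ s, g j (y j)) ^ 2 ≤ s.card := by
  have h : ∀ j ∈ s, ∑ l ∈ s, ∑ y : ι → α, (∏ k, p k (y k)) * (g j (y j) * g l (y l)) ≤ 1 := by
    intro j hj
    rw [Finset.sum_eq_single_of_mem j hj fun l _ hl =>
      sum_prod_mul_mul_eq_zero hl.symm (hg j hj), ← sum_prod_eq_one hp]
    refine Finset.sum_le_sum fun y _ => ?_
    refine mul_le_of_le_one_right (Finset.prod_nonneg fun k _ => hp0 k _) ?_
    rw [← sq, sq_le_one_iff_abs_le_one]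
    exact hg1 j _
  calc _ = ∑ j ∈ s, ∑ l ∈ s, ∑ y : ι → α, (∏ k, p k (y k)) * (g j (y j) * g l (y l)) := by
        simp only [sq, Finset.sum_mul_sum]
        simp only [Finset.mul_sum]
        rw [Finset.sum_comm]
        exact Finset.sum_congr rfl fun j _ => Finset.sum_comm
    _ ≤ ∑ j ∈ s, 1 := Finset.sum_le_sum h
    _ = s.card := by simp

/-- The first moment of a sum of independent centred variables with values in `[-1, 1]`. -/
theorem sum_prod_mul_abs_le (hp0 : ∀ j a, 0 ≤ p j a) (hp : ∀ j, ∑ a, p j a = 1) {s : Finset ι}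
    (hs : s.Nonempty) {g : ι → α → ℝ} (hg : ∀ j ∈ s, ∑ a, p j a * g j a = 0)
    (hg1 : ∀ j a, |g j a| ≤ 1) :
    ∑ y : ι → α, (∏ k, p k (y k)) * |∑ j ∈ s, g j (y j)| ≤ √(s.card : ℝ) := by
  have hc : 0 < √(s.card : ℝ) := Real.sqrt_pos.2 (by exact_mod_cast hs.card_pos)
  have hsq : √(s.card : ℝ) ^ 2 = s.card := Real.sq_sqrt (Nat.cast_nonneg _)
  -- Cauchy–Schwarz is replaced by `2√n |S| ≤ S² + n`, averaged against the weights.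
  refine le_of_mul_le_mul_left ?_ (mul_pos two_pos hc)
  calc 2 * √(s.card : ℝ) * ∑ y : ι → α, (∏ k, p k (y k)) * |∑ j ∈ s, g j (y j)|
      ≤ ∑ y : ι → α, ((∏ k, p k (y k)) * (∑ j ∈ s, g j (y j)) ^ 2 +
          (∏ k, p k (y k)) * s.card) := by
        rw [Finset.mul_sum]
        refine Finset.sum_le_sum fun y _ => ?_
        rw [← mul_add, mul_left_comm]
        refine mul_le_mul_of_nonneg_left ?_ (Finset.prod_nonneg fun k _ => hp0 k _)
        have h := two_mul_le_add_sq (√(s.card : ℝ)) |∑ j ∈ s, g j (y j)|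
        rwa [hsq, sq_abs, add_comm] at h
    _ ≤ s.card + 1 * s.card := by
        rw [Finset.sum_add_distrib, ← Finset.sum_mul, sum_prod_eq_one hp]
        gcongr
        exact sum_prod_mul_sq_le hp0 hp s hg hg1
    _ = _ := by rw [mul_assoc, ← sq, hsq]; ring

end ProductWeights

variable {d N : ℕ}

/-- The law of the state of player `j` when player `i` is at `x` and the others have law `m₀`. -/
noncomputable def playerLaw (i : Fin N) (x : Fin d) (m₀ : Vec d) (j : Fin N) : Vec d :=
  if j = i then dirac x else m₀

theorem playerLaw_mem_simplex (i : Fin N) (x : Fin d) {m₀ : Vec d} (hm : m₀ ∈ simplex d)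
    (j : Fin N) : playerLaw i x m₀ j ∈ simplex d := by
  unfold playerLaw
  split_ifs
  exacts [dirac_mem_simplex x, hm]

theorem prod_playerLaw (i : Fin N) (x : Fin d) (m₀ : Vec d) (y : Fin N → Fin d) :
    ∏ j, playerLaw i x m₀ j (y j) =
      if y i = x then ∏ j ∈ Finset.univ.erase i, m₀ (y j) else 0 := by
  rw [← Finset.mul_prod_erase _ _ (Finset.mem_univ i), Finset.prod_congr rfl fun j hj => by
    rw [playerLaw, if_neg (Finset.ne_of_mem_erase hj)], playerLaw, if_pos rfl, dirac_apply]
  split_ifs <;> simp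

/-- Fixing player `i` at `x` amounts to giving it a Dirac law, which turns the restricted sum into
an expectation under a product law. -/
theorem averaged_eq (v : Fin N → ℝ → (Fin N → Fin d) → ℝ) (i : Fin N) (t : ℝ) (x : Fin d)
    (m₀ : Vec d) :
    averaged v i t x m₀ = ∑ y : Fin N → Fin d, (∏ j, playerLaw i x m₀ j (y j)) * v i t y := by
  rw [averaged, Finset.sum_filter]
  refine Finset.sum_congr rfl fun y _ => ?_
  rw [prod_playerLaw]
  split_ifs <;> ring

/-- The law of large numbers for the empirical measure of the other players. -/
theorem sum_playerLaw_mul_abs_le (hN : 2 ≤ N) (i : Fin N) (x : Fin d) {m₀ : Vec d}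
    (hm : m₀ ∈ simplex d) (k : Fin d) :
    ∑ y : Fin N → Fin d, (∏ j, playerLaw i x m₀ j (y j)) * |empiricalExcept i y k - m₀ k| ≤
      1 / √((N : ℝ) - 1) := by
  have h1 := sub_one_pos_of_two_le hN
  have hlaw := playerLaw_mem_simplex i x hm
  have key := sum_prod_mul_abs_le (p := fun j a => playerLaw i x m₀ j a)
    (s := Finset.univ.erase i) (g := fun _ a => dirac a k - m₀ k) (fun j => (hlaw j).1)
    (fun j => (hlaw j).2)
    (Finset.card_pos.1 (by exact_mod_cast (card_erase_cast i).symm ▸ h1))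
    (fun j hj => by
      simp [playerLaw, Finset.ne_of_mem_erase hj, mul_sub, Finset.sum_sub_distrib,
        ← Finset.sum_mul, hm.2, dirac_apply])
    (fun _ a => by
      have h2 := hm.1 k
      have h3 := le_one_of_mem_simplex hm k
      rw [dirac_apply, abs_le]
      split_ifs <;> constructor <;> linarith)
  rw [card_erase_cast] at key
  have heq : ∀ y : Fin N → Fin d, |empiricalExcept i y k - m₀ k| =
      ((N : ℝ) - 1)⁻¹ * |∑ j ∈ Finset.univ.erase i, (dirac (y j) k - m₀ k)| := fun y => by
    rw [← abs_of_pos (inv_pos.2 h1)]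
    rw [← abs_mul, Finset.sum_sub_distrib, Finset.sum_const, nsmul_eq_mul, card_erase_cast, mul_sub,
      inv_mul_cancel_left₀ h1.ne']
    simp [empiricalExcept]
  simp only [heq, mul_left_comm _ (((N : ℝ) - 1)⁻¹)]
  rw [← Finset.mul_sum]
  calc _ ≤ ((N : ℝ) - 1)⁻¹ * √((N : ℝ) - 1) := mul_le_mul_of_nonneg_left key (inv_nonneg.2 h1.le)
    _ = _ := by
      rw [inv_mul_eq_div, Real.sqrt_div_self']

/-! ### Passage to the full empirical measure and to the average -/

namespace Game.Estimates

variable {𝓖 : Game d} {U : ℝ → Fin d → Vec d → ℝ} {D : ℝ → Fin d → Vec d → Fin d → Vec d}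
  {B R C : ℝ} {t : ℝ} {v : Fin N → ℝ → (Fin N → Fin d) → ℝ} {ε : ℝ}

theorem abs_sub_empirical_le (hE : 𝓖.Estimates U D B R C)
    (hN : 2 ≤ N) (ht : t ∈ Icc 0 𝓖.T)
    (hv : ∀ i x, |playerValue U i t x - v i t x| ≤ ε) (i : Fin N) (x : Fin N → Fin d) :
    |v i t x - U t (x i) (empirical x)| ≤ ε + R * (2 / N) := by
  have h1 := hE.abs_sub_le_sum ht (x i) (empiricalExcept_mem_simplex hN i x)
    (empirical_mem_simplex hN x)
  have h2 := mul_le_mul_of_nonneg_left (sum_abs_empirical_sub_le hN i x) hE.R_nonneg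
  have h3 := abs_sub_le (v i t x) (playerValue U i t x) (U t (x i) (empirical x))
  have h4 := hv i x
  rw [abs_sub_comm] at h4
  simp only [playerValue] at h3 h4
  linarith

theorem abs_averaged_sub_le (hE : 𝓖.Estimates U D B R C)
    (hN : 2 ≤ N) (ht : t ∈ Icc 0 𝓖.T)
    (hv : ∀ i x, |playerValue U i t x - v i t x| ≤ ε) {m₀ : Vec d} (hm : m₀ ∈ simplex d)
    (i : Fin N) (x : Fin d) :
    |averaged v i t x m₀ - U t x m₀| ≤ ε + R * (d * (1 / √((N : ℝ) - 1))) := by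
  set W : (Fin N → Fin d) → ℝ := fun y => ∏ j, playerLaw i x m₀ j (y j) with hW
  have hlaw := playerLaw_mem_simplex i x hm
  have hW0 : ∀ y, 0 ≤ W y := fun y => Finset.prod_nonneg fun j _ => (hlaw j).1 _
  have hW1 : ∑ y, W y = 1 := sum_prod_eq_one (p := fun j a => playerLaw i x m₀ j a)
    fun j => (hlaw j).2
  have hpt : ∀ y, |W y * (v i t y - U t x m₀)| ≤
      W y * ε + R * ∑ k, W y * |empiricalExcept i y k - m₀ k| := fun y => by
    -- `playerValue` sees the state `y i`; configurations where it is not `x` carry no weight.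
    by_cases hy : y i = x
    · rw [abs_mul, abs_of_nonneg (hW0 y), ← Finset.mul_sum, mul_left_comm, ← mul_add]
      refine mul_le_mul_of_nonneg_left ?_ (hW0 y)
      have h1 := hE.abs_sub_le_sum ht x (empiricalExcept_mem_simplex hN i y) hm
      have h2 := hv i y
      rw [abs_sub_comm] at h2
      simp only [playerValue, hy] at h2
      linarith [abs_sub_le (v i t y) (U t x (empiricalExcept i y)) (U t x m₀)]
    · have : W y = 0 := by rw [hW]; simp only [prod_playerLaw, if_neg hy]
      simp [this]
  calc |averaged v i t x m₀ - U t x m₀| = |∑ y, W y * (v i t y - U t x m₀)| := by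
        simp only [averaged_eq, mul_sub, Finset.sum_sub_distrib, ← Finset.sum_mul]
        rw [show ∑ y : Fin N → Fin d, ∏ j, playerLaw i x m₀ j (y j) = 1 from hW1, one_mul]
    _ ≤ ∑ y, (W y * ε + R * ∑ k, W y * |empiricalExcept i y k - m₀ k|) :=
        (Finset.abs_sum_le_sum_abs _ _).trans (Finset.sum_le_sum fun y _ => hpt y)
    _ = ε + R * ∑ k, ∑ y, W y * |empiricalExcept i y k - m₀ k| := by
        rw [Finset.sum_add_distrib, ← Finset.sum_mul, hW1, one_mul, ← Finset.mul_sum,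
          Finset.sum_comm]
    _ ≤ ε + R * ∑ _k : Fin d, 1 / √((N : ℝ) - 1) := by
        gcongr with k
        · exact hE.R_nonneg
        · exact sum_playerLaw_mul_abs_le hN i x hm k
    _ = _ := by simp

end Game.Estimates

theorem normL1_le {m₀ : Vec d} (hm : m₀ ∈ simplex d) {g : Fin d → ℝ} {b : ℝ}
    (hg : ∀ x, |g x| ≤ b) : normL1 m₀ g ≤ b :=
  calc normL1 m₀ g ≤ ∑ x, b * m₀ x :=
        Finset.sum_le_sum fun x _ => mul_le_mul_of_nonneg_right (hg x) (hm.1 x)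
    _ = b := by rw [← Finset.mul_sum, hm.2, mul_one]

end FiniteMFG

theorem theorem3p1 {d : ℕ} (𝓖 : FiniteMFG.Game d) (K : ℝ) (hK : 𝓖.LargeRadius K) (hH1 : 𝓖.H1 K)
    (U : ℝ → Fin d → FiniteMFG.Vec d → ℝ) (hU : 𝓖.IsRegularSolution U) :
    ∃ C : ℝ, ∀ N : ℕ, 2 ≤ N → ∀ v : Fin N → ℝ → (Fin N → Fin d) → ℝ, 𝓖.IsHJBSolution v →
      ∀ t₀ ∈ Set.Icc 0 𝓖.T,
        (∀ x : Fin N → Fin d,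
          1 / (N : ℝ) * ∑ i, |v i t₀ x - U t₀ (x i) (FiniteMFG.empirical x)| ≤ C / N) ∧
        (∀ m₀ ∈ FiniteMFG.simplex d, ∀ i : Fin N,
          FiniteMFG.normL1 m₀ (fun x => FiniteMFG.averaged v i t₀ x m₀ - U t₀ x m₀) ≤
            C / √(N : ℝ)) := by
  -- Without states there are neither configurations nor probability measures; the a priori bounds
  -- need a state.
  rcases Nat.eq_zero_or_pos d with rfl | hd
  · exact ⟨0, fun N hN v _ t _ => ⟨fun x => (x ⟨0, by omega⟩).elim0,
      fun m₀ hm _ => absurd hm.2 (by simp)⟩⟩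
  obtain ⟨Ut, D, hU, C₀, hD⟩ := hU
  obtain ⟨B, R, C, hE, hvB⟩ := hU.exists_estimates hD hK hH1 hd
  have hC := hE.C_nonneg
  have hR := hE.R_nonneg
  have hM : 0 ≤ 𝓖.M := 𝓖.κ_pos.le.trans 𝓖.κ_le_M
  set E : ℝ := (2 * C * R ^ 2 + 𝓖.M * R) * d *
    Real.exp ((2 * C * √(d : ℝ) + 2 * C * d * R + 1) * 𝓖.T) with hEdef
  have hE0 : 0 ≤ E := by positivity
  -- The terms come from the comparison with `1/(N-1) ≤ 2/N`, the change of empirical measure, and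
  -- the law of large numbers with `1/√(N-1) ≤ 2/√N`.
  refine ⟨2 * E + 2 * R + 2 * R * d, fun N hN v hv t ht => ?_⟩
  have hN2 : (2 : ℝ) ≤ N := by exact_mod_cast hN
  have h1 := FiniteMFG.sub_one_pos_of_two_le hN
  have hN0 : (0 : ℝ) < N := by linarith
  have hsN : 0 < √(N : ℝ) := Real.sqrt_pos.2 hN0
  have hinv : ((N : ℝ) - 1)⁻¹ ≤ 2 / N := by
    rw [inv_le_comm₀ h1 (by positivity), inv_div]
    linarith
  have hcomp : ∀ i x, |FiniteMFG.playerValue U i t x - v i t x| ≤ E * (2 / N) := fun i x =>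
    calc _ ≤ E * ((N : ℝ) - 1)⁻¹ :=
          (hE.abs_playerValue_sub_le hN hU hv (hvB N hN v hv) ht i x).trans_eq (by
            rw [hEdef]; ring)
      _ ≤ E * (2 / N) := mul_le_mul_of_nonneg_left hinv hE0
  constructor
  · intro x
    have hsum : ∑ i, |v i t x - U t (x i) (FiniteMFG.empirical x)| ≤
        ∑ _i : Fin N, (E * (2 / N) + R * (2 / N)) :=
      Finset.sum_le_sum fun i _ => hE.abs_sub_empirical_le hN ht hcomp i x
    calc _ ≤ 1 / (N : ℝ) * ∑ _i : Fin N, (E * (2 / N) + R * (2 / N)) := by gcongr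
      _ = (2 * E + 2 * R) / N := by
        rw [Finset.sum_const, Finset.card_univ, Fintype.card_fin, nsmul_eq_mul]
        field_simp
      _ ≤ _ := by
        refine div_le_div_of_nonneg_right ?_ hN0.le
        exact le_add_of_nonneg_right (by positivity)
  · intro m₀ hm i
    have hs1 : 2 / (N : ℝ) ≤ 2 / √(N : ℝ) := by
      gcongr
      rw [Real.sqrt_le_left hN0.le]
      nlinarith
    have hs2 : 1 / √((N : ℝ) - 1) ≤ 2 / √(N : ℝ) := by
      rw [div_le_div_iff₀ (Real.sqrt_pos.2 h1) hsN, one_mul,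
        Real.sqrt_le_left (by positivity), mul_pow, Real.sq_sqrt h1.le]
      linarith
    refine FiniteMFG.normL1_le hm fun x => ?_
    calc _ ≤ E * (2 / N) + R * (d * (1 / √((N : ℝ) - 1))) :=
          hE.abs_averaged_sub_le hN ht hcomp hm i x
      _ ≤ E * (2 / √(N : ℝ)) + R * (d * (2 / √(N : ℝ))) := by gcongr
      _ = (2 * E + 2 * R * d) / √(N : ℝ) := by ring
      _ ≤ _ := by
        gcongr
        linarith
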